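/- Let $q\in\mathbb{C}$ with $|q|<1$. Write $(a;q)_n=\prod_{i=0}^{n-1}(1-aq^i)$, $(a_1,\dots,a_j;q)_n=(a_1;q)_n\cdots(a_j;q)_n$, and let $\phi(q)=\sum_{n=-\infty}^{\infty}q^{n^2}$. Then \begin{align*} \phi(q)^2&=1-4\sum_{n=1}^{\infty}\frac{(-1)^nq^{2n^2-n}}{(q;q^4)_n(1-q^{4n})}+4\sum_{n=1}^{\infty}\frac{(-1)^nq^{2n^2+n}}{(q^3;q^4)_n(1-q^{4n})}\\ &=1+4\sum_{n=1}^{\infty}\frac{(1-q^{8n-3})q^{4n^2-3n}}{(1-q^{4n-3})(1-q^{4n})}-4\sum_{n=1}^{\infty}\frac{(1-q^{8n-1})q^{4n^2-n}}{(1-q^{4n-1})(1-q^{4n})}. \end{align*} Moreover, if $q\neq 0$, then for all $c,d\in\mathbb{C}$ for which no denominator below vanishes (that is, $c,d\neq0$ and $(q^3/c,q^3/d,q/c,q/d;q^4)_n\neq0$ for all $n\ge 1$), \begin{align*} \phi(q)^2={}&1+4\sum_{n=1}^{\infty}\frac{(q^4;q^4)_{n-1}(q^3/cd;q^4)_n(-1)^nq^{2n^2+n}}{(q^3/c,q^3/d,q^4;q^4)_n}\\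 &-4\sum_{n=1}^{\infty}\frac{(q^4;q^4)_{n-1}(q/cd;q^4)_n(-1)^nq^{2n^2-n}}{(q/c,q/d,q^4;q^4)_n}\\ &-4\sum_{n=1}^{\infty}\frac{(1-q^{8n-1})(q^4;q^4)_{n-1}(1/q,c,d;q^4)_n\,q^{4n^2+2n}}{(1-1/q)(q^3/c,q^3/d,q^3,q^4;q^4)_n\,c^nd^n}\\ &+4\sum_{n=1}^{\infty}\frac{(1-q^{8n-3})(q^4;q^4)_{n-1}(1/q^3,c,d;q^4)_n\,q^{4n^2-2n}}{(1-1/q^3)(q/c,q/d,q,q^4;q^4)_n\,c^nd^n}. \end{align*} All the series converge absolutely. -/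

import Mathlib

/-- The finite `q`-shifted factorial `(a;q)_n = (1 - a)(1 - a q) ⋯ (1 - a q^(n-1))`. -/
noncomputable def qPoch (a q : ℂ) (n : ℕ) : ℂ :=
  ∏ i ∈ Finset.range n, (1 - a * q ^ i)

/-- Ramanujan's theta function `φ(q) = ∑_{n ∈ ℤ} q^(n²)`. -/
noncomputable def ramanujanPhi (q : ℂ) : ℂ :=
  ∑' n : ℤ, q ^ (n ^ 2)

/-! Write L(x) = ∑_{m≥1} x^m/(1-p^m). With p = q^4 everything reduces to φ(q)^2 = 1 + 4(L(q) -
L(q^3)) and to three other expansions of L(x), used at x = q and x = q^3.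

The two-squares formula comes from the very-well-poised ₆φ₅ series with a = x/p. Its parameters
enter through their inverses B, C, E, so that sending a parameter to infinity means setting its
inverse to 0. A contiguous relation E ↦ pE (`vwp_partial_contiguous`) telescopes termwise; iterating
it moves E to 0, and E = 1, where the series is just 1, calibrates the value there. At x = p, the
choice (B, C, E) = (-1, 0, 0) gives the alternating theta series and (i, -i, -1) a Lambert series;
the infinite products make the second the square of the first (`gauss_sq_eq_lambert`).

First expansion: ∑ `lambertTerm` and -L obey the same functional equation in x ↦ xp and both vanish
as x p^k → 0 (`hasSum_lambertTerm`).

Two-parameter expansion, by Bailey's method: the terminating ₆φ₅ sum with E = p^n turns each term of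
the first series into a balanced term. Interchanging the double sum leaves an inner ₁φ₁, summable by
`tsum_phiTerm`, whose value yields the well-poised term (`lambert_eq_wellPoised_sub_balanced`).

Second expansion: the case c = -1, d = -x, where the balanced series vanishes
(`hasSum_clausenTerm`). -/

open Filter Topology

/-! ### Algebra of finite shifted factorials -/

/-- The product `(a - 1)(a - p) ⋯ (a - p^(n-1))`, equal to `a^n (1/a;p)_n` for `a ≠ 0`. -/
noncomputable def altPoch (a p : ℂ) (n : ℕ) : ℂ :=
  ∏ i ∈ Finset.range n, (a - p ^ i)

@[simp] lemma qPoch_zero (a p : ℂ) : qPoch a p 0 = 1 := by simp [qPoch]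

@[simp] lemma altPoch_zero (a p : ℂ) : altPoch a p 0 = 1 := by simp [altPoch]

lemma qPoch_succ (a p : ℂ) (n : ℕ) : qPoch a p (n + 1) = qPoch a p n * (1 - a * p ^ n) := by
  simp [qPoch, Finset.prod_range_succ]

lemma altPoch_succ (a p : ℂ) (n : ℕ) : altPoch a p (n + 1) = altPoch a p n * (a - p ^ n) := by
  simp [altPoch, Finset.prod_range_succ]

lemma qPoch_add (a p : ℂ) (m n : ℕ) :
    qPoch a p (m + n) = qPoch a p m * qPoch (a * p ^ m) p n := by
  simp only [qPoch, Finset.prod_range_add]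
  congr 1
  exact Finset.prod_congr rfl fun i _ => by ring

lemma qPoch_succ' (a p : ℂ) (n : ℕ) : qPoch a p (n + 1) = (1 - a) * qPoch (a * p) p n := by
  rw [add_comm, qPoch_add]; simp [qPoch_succ]

@[simp] lemma qPoch_zero_left (p : ℂ) (n : ℕ) : qPoch 0 p n = 1 := by simp [qPoch]

lemma qPoch_one_succ (p : ℂ) (n : ℕ) : qPoch 1 p (n + 1) = 0 := by simp [qPoch_succ']

lemma altPoch_one_succ (p : ℂ) (n : ℕ) : altPoch 1 p (n + 1) = 0 := by
  simp [altPoch, Finset.prod_range_succ']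

lemma altPoch_pow_eq_zero (p : ℂ) {n r : ℕ} (h : n < r) : altPoch (p ^ n) p r = 0 :=
  Finset.prod_eq_zero (Finset.mem_range.2 h) (sub_self _)

lemma altPoch_zero_left (p : ℂ) (n : ℕ) : altPoch 0 p n = (-1) ^ n * p ^ (n.choose 2) := by
  induction n with
  | zero => simp
  | succ n ih =>
    rw [altPoch_succ, ih, Nat.choose_succ_succ' n 1, Nat.choose_one_right]
    ring

lemma altPoch_inv {c : ℂ} (hc : c ≠ 0) (p : ℂ) (n : ℕ) :
    altPoch c⁻¹ p n = qPoch c p n / c ^ n := by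
  induction n with
  | zero => simp
  | succ n ih => rw [altPoch_succ, qPoch_succ, ih]; field_simp; ring

/-- Shifting the argument of `altPoch` by a factor `p`. -/
lemma altPoch_mul_succ (a p : ℂ) (n : ℕ) :
    altPoch (p * a) p (n + 1) = (p * a - 1) * p ^ n * altPoch a p n := by
  induction n with
  | zero => simp [altPoch_succ]
  | succ n ih => rw [altPoch_succ, ih, altPoch_succ a]; ring

/-- Division-free form of (p^(-n);p)_r = (-1)^r p^(r(r-1)/2 - nr) (p)_n/(p)_(n-r), with n = r + m.
-/
lemma altPoch_pow_add (p : ℂ) (r m : ℕ) :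
    altPoch (p ^ (r + m)) p r * qPoch p p m
      = (-1) ^ r * p ^ (r.choose 2) * qPoch p p (r + m) := by
  induction r generalizing m with
  | zero => simp
  | succ r ih =>
    have h := ih (m + 1)
    rw [show r + (m + 1) = r + 1 + m by ring, qPoch_succ p p m] at h
    rw [altPoch_succ, Nat.choose_succ_succ' r 1, Nat.choose_one_right]
    calc altPoch (p ^ (r + 1 + m)) p r * (p ^ (r + 1 + m) - p ^ r) * qPoch p p m
        = -p ^ r * (altPoch (p ^ (r + 1 + m)) p r * (qPoch p p m * (1 - p * p ^ m))) := by ring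
      _ = _ := by rw [h]; ring

/-! ### Non-vanishing, limits and uniform bounds -/

lemma one_sub_mul_pow_ne_zero {a p : ℂ} (ha : ‖a‖ < 1) (hp : ‖p‖ < 1) (n : ℕ) :
    1 - a * p ^ n ≠ 0 := by
  intro h
  have h1 : a * p ^ n = 1 := (sub_eq_zero.1 h).symm
  have h2 : ‖a * p ^ n‖ < 1 := by
    rw [norm_mul, norm_pow]
    exact mul_lt_one_of_nonneg_of_lt_one_left (norm_nonneg _) ha
      (pow_le_one₀ (norm_nonneg _) hp.le)
  rw [h1, norm_one] at h2
  exact lt_irrefl _ h2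

lemma qPoch_ne_zero {a p : ℂ} (ha : ‖a‖ < 1) (hp : ‖p‖ < 1) (n : ℕ) : qPoch a p n ≠ 0 :=
  Finset.prod_ne_zero_iff.2 fun i _ => one_sub_mul_pow_ne_zero ha hp i

lemma summable_norm_mul_pow (a : ℂ) {p : ℂ} (hp : ‖p‖ < 1) :
    Summable fun n : ℕ => ‖-(a * p ^ n)‖ := by
  simp only [norm_neg, norm_mul, norm_pow]
  exact (summable_geometric_of_lt_one (norm_nonneg _) hp).mul_left _

lemma exists_tendsto_qPoch (a : ℂ) {p : ℂ} (hp : ‖p‖ < 1) :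
    ∃ l : ℂ, Tendsto (qPoch a p) atTop (𝓝 l) ∧ ((∀ n, qPoch a p n ≠ 0) → l ≠ 0) := by
  refine ⟨∏' n : ℕ, (1 + -(a * p ^ n)), ?_, fun h => ?_⟩
  · have := (multipliable_one_add_of_summable (summable_norm_mul_pow a hp)).tendsto_prod_tprod_nat
    refine this.congr fun n => ?_
    simp only [qPoch, sub_eq_add_neg]
  · refine tprod_one_add_ne_zero_of_summable (fun n hn => h (n + 1) ?_)
      (summable_norm_mul_pow a hp)
    rw [qPoch_succ, sub_eq_add_neg, hn, mul_zero]

lemma exists_bound_qPoch (a : ℂ) {p : ℂ} (hp : ‖p‖ < 1) : ∃ M : ℝ, ∀ n, ‖qPoch a p n‖ ≤ M := by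
  obtain ⟨l, hl, -⟩ := exists_tendsto_qPoch a hp
  obtain ⟨M, hM⟩ := hl.norm.bddAbove_range
  exact ⟨M, fun n => hM ⟨n, rfl⟩⟩

lemma exists_bound_inv_qPoch {a p : ℂ} (hp : ‖p‖ < 1) (h : ∀ n, qPoch a p n ≠ 0) :
    ∃ M : ℝ, ∀ n, ‖(qPoch a p n)⁻¹‖ ≤ M := by
  obtain ⟨l, hl, h0⟩ := exists_tendsto_qPoch a hp
  obtain ⟨M, hM⟩ := (hl.inv₀ (h0 h)).norm.bddAbove_range
  exact ⟨M, fun n => hM ⟨n, rfl⟩⟩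

lemma qPoch_shift_ne_zero {a p : ℂ} (h : ∀ n, qPoch a p n ≠ 0) (k n : ℕ) :
    qPoch (a * p ^ k) p n ≠ 0 := by
  have := h (k + n)
  rw [qPoch_add] at this
  exact right_ne_zero_of_mul this

/-- The inverse is (a)_k/(a)_(k+n), so one bound serves every shift k; this is what dominated
convergence along E p^k needs. -/
lemma exists_bound_inv_qPoch_shift {a p : ℂ} (hp : ‖p‖ < 1) (h : ∀ n, qPoch a p n ≠ 0) :
    ∃ M : ℝ, ∀ k n, ‖(qPoch (a * p ^ k) p n)⁻¹‖ ≤ M := by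
  obtain ⟨M, hM⟩ := exists_bound_qPoch a hp
  obtain ⟨N, hN⟩ := exists_bound_inv_qPoch hp h
  refine ⟨M * N, fun k n => ?_⟩
  have : (qPoch (a * p ^ k) p n)⁻¹ = qPoch a p k * (qPoch a p (k + n))⁻¹ := by
    rw [qPoch_add]
    have h1 := h k
    have h2 := qPoch_shift_ne_zero h k n
    field_simp
  rw [this, norm_mul]
  exact mul_le_mul (hM k) (hN _) (norm_nonneg _) ((norm_nonneg _).trans (hM 0))

lemma exists_bound_altPoch {p : ℂ} (hp : ‖p‖ < 1) :
    ∃ M : ℝ, ∀ a : ℂ, ‖a‖ ≤ 1 → ∀ n, ‖altPoch a p n‖ ≤ M := by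
  have hp' : ‖((‖p‖ : ℝ) : ℂ)‖ < 1 := by simpa using hp
  -- Each factor satisfies |a - p^i| ≤ 1 + |p|^i, so (-1;|p|)_n is a majorant.
  obtain ⟨M, hM⟩ := exists_bound_qPoch (-1) hp'
  refine ⟨M, fun a ha n => le_trans ?_ (hM n)⟩
  rw [altPoch, qPoch, norm_prod, norm_prod]
  refine Finset.prod_le_prod (fun _ _ => norm_nonneg _) fun i _ => ?_
  have : (1 - -1 * ((‖p‖ : ℝ) : ℂ) ^ i) = ((1 + ‖p‖ ^ i : ℝ) : ℂ) := by push_cast; ring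
  rw [this, Complex.norm_real, Real.norm_of_nonneg (by positivity)]
  calc ‖a - p ^ i‖ ≤ ‖a‖ + ‖p ^ i‖ := norm_sub_le _ _
    _ ≤ 1 + ‖p‖ ^ i := by rw [norm_pow]; gcongr

lemma norm_altPoch_le (a : ℂ) {p : ℂ} (hp : ‖p‖ < 1) (n : ℕ) :
    ‖altPoch a p n‖ ≤ (‖a‖ + 1) ^ n := by
  rw [altPoch, norm_prod]
  calc _ ≤ ∏ _i ∈ Finset.range n, (‖a‖ + 1) := by
        refine Finset.prod_le_prod (fun _ _ => norm_nonneg _) fun i _ => ?_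
        refine (norm_sub_le _ _).trans ?_
        rw [norm_pow]
        gcongr
        exact pow_le_one₀ (norm_nonneg _) hp.le
    _ = _ := by simp

/-- The product is zero once r > n, and otherwise |p^n - p^i| ≤ 2|p|^i for i < r. The Gaussian decay
in r, uniform in n, outweighs any exponential growth from B and C. -/
lemma norm_altPoch_pow_le {p : ℂ} (hp : ‖p‖ < 1) (n r : ℕ) :
    ‖altPoch (p ^ n) p r‖ ≤ 2 ^ r * ‖p‖ ^ (r.choose 2) := by
  induction r with
  | zero => simp
  | succ r ih =>
    rcases lt_or_ge n (r + 1) with h | h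
    · rw [altPoch_pow_eq_zero p h, norm_zero]; positivity
    · rw [altPoch_succ, norm_mul, Nat.choose_succ_succ' r 1, Nat.choose_one_right]
      have : ‖p ^ n - p ^ r‖ ≤ 2 * ‖p‖ ^ r := by
        refine (norm_sub_le _ _).trans ?_
        rw [norm_pow, norm_pow]
        have := pow_le_pow_of_le_one (norm_nonneg p) hp.le (show r ≤ n by lia)
        linarith
      calc _ ≤ (2 ^ r * ‖p‖ ^ (r.choose 2)) * (2 * ‖p‖ ^ r) :=
            mul_le_mul ih this (norm_nonneg _) (by positivity)
        _ = _ := by ring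

lemma summable_pow_mul_pow_choose (K : ℝ) {t : ℝ} (h0 : 0 ≤ t) (h1 : t < 1) :
    Summable fun n : ℕ => K ^ n * t ^ (n.choose 2) := by
  have hlim : Tendsto (fun n : ℕ => |K| * t ^ n) atTop (𝓝 0) := by
    simpa using (tendsto_pow_atTop_nhds_zero_of_lt_one h0 h1).const_mul |K|
  refine summable_of_ratio_norm_eventually_le (r := 1 / 2) (by norm_num) ?_
  filter_upwards [hlim.eventually (eventually_le_nhds (show (0 : ℝ) < 1 / 2 by norm_num))]
    with n hn
  rw [Nat.choose_succ_succ' n 1, Nat.choose_one_right]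
  have : K ^ (n + 1) * t ^ (n + n.choose (1 + 1)) = (K * t ^ n) * (K ^ n * t ^ (n.choose 2)) := by
    ring
  rw [this, norm_mul]
  refine mul_le_mul_of_nonneg_right ?_ (norm_nonneg _)
  rwa [norm_mul, Real.norm_eq_abs, norm_pow, Real.norm_of_nonneg h0]

/-! ### The very-well-poised ₆φ₅ sum -/

/-- The term of index `r + 1` of the very-well-poised `₆φ₅` series with parameters
`a = x / p` and `b, c, d`, written in terms of `B = 1/b`, `C = 1/c`, `E = 1/d`. -/
noncomputable def vwpTerm (x p B C E : ℂ) (r : ℕ) : ℂ :=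
  (1 - x * p ^ (2 * r + 1)) * qPoch x p r * x ^ (r + 1) *
      (altPoch B p (r + 1) * altPoch C p (r + 1) * altPoch E p (r + 1)) /
    (qPoch p p (r + 1) * qPoch (x * B) p (r + 1) * qPoch (x * C) p (r + 1) *
      qPoch (x * E) p (r + 1))

/-- The certificate of the contiguous relation `E ↦ p E` for `vwpTerm`. -/
noncomputable def vwpCert (x p B C E : ℂ) (R : ℕ) : ℂ :=
  E * x ^ (R + 1) * qPoch x p R * altPoch B p (R + 1) * altPoch C p (R + 1) * altPoch E p R *
      (1 - x * E) /
    (qPoch p p R * qPoch (x * B) p R * qPoch (x * C) p R * qPoch (x * E) p (R + 1))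

/-- The weighted difference of the two summands is a difference of consecutive certificates, so
partial sums agree up to one boundary term. That term vanishes for E = p^n with n < R, and tends to
0 in the convergent case. -/
lemma vwp_partial_contiguous {x p B C E : ℂ} (hp : ‖p‖ < 1)
    (hB : ∀ n, qPoch (x * B) p n ≠ 0) (hC : ∀ n, qPoch (x * C) p n ≠ 0)
    (hE : ∀ n, qPoch (x * E) p n ≠ 0) (R : ℕ) :
    (1 - x * E) * (1 - x * B * C * E) * (1 + ∑ r ∈ Finset.range R, vwpTerm x p B C E r)
      - (1 - x * B * E) * (1 - x * C * E) *
          (1 + ∑ r ∈ Finset.range R, vwpTerm x p B C (p * E) r)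
      = -vwpCert x p B C E R := by
  have h1E : 1 - x * E ≠ 0 := by simpa [qPoch_succ] using hE 1
  induction R with
  | zero =>
    simp only [Finset.range_zero, Finset.sum_empty, vwpCert, altPoch_succ, altPoch_zero,
      qPoch_succ, qPoch_zero, pow_zero, mul_one, one_mul]
    field_simp
    ring
  | succ R ih =>
    rw [Finset.sum_range_succ, Finset.sum_range_succ]
    suffices h : (1 - x * E) * (1 - x * B * C * E) * vwpTerm x p B C E R
        - (1 - x * B * E) * (1 - x * C * E) * vwpTerm x p B C (p * E) R
        = vwpCert x p B C E R - vwpCert x p B C E (R + 1) by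
      linear_combination ih + h
    -- Every shifted factorial is brought back to index R with unshifted parameters, leaving a
    -- rational identity.
    have e : qPoch (x * (p * E)) p (R + 1) = qPoch (x * E) p (R + 2) / (1 - x * E) := by
      rw [qPoch_succ' (x * E)]
      field_simp
    have hp1 := one_sub_mul_pow_ne_zero hp hp R
    have hp0 := qPoch_ne_zero hp hp R
    have hB0 := hB R
    have hC0 := hC R
    have hE0 := hE R
    have hB1 := hB (R + 1)
    have hC1 := hC (R + 1)
    have hE1 := hE (R + 1)
    have hE2 := hE (R + 2)
    rw [qPoch_succ] at hB1 hC1 hE1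
    rw [qPoch_succ, qPoch_succ] at hE2
    replace hB1 := right_ne_zero_of_mul hB1
    replace hC1 := right_ne_zero_of_mul hC1
    replace hE1 := right_ne_zero_of_mul hE1
    replace hE2 := right_ne_zero_of_mul hE2
    have e0 := altPoch_mul_succ E p R
    simp only [vwpTerm, vwpCert, e, e0, altPoch_succ _ _ R, altPoch_succ _ _ (R + 1),
      qPoch_succ _ _ R, qPoch_succ _ _ (R + 1)]
    generalize altPoch B p R = b at *
    generalize altPoch C p R = c at *
    generalize altPoch E p R = e at *
    generalize qPoch x p R = X at *
    generalize qPoch p p R = P at *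
    generalize qPoch (x * B) p R = Bp at *
    generalize qPoch (x * C) p R = Cp at *
    generalize qPoch (x * E) p R = Ep at *
    have e1 : p ^ (R + 1) = p * p ^ R := by ring
    have e2 : p ^ (2 * R + 1) = p * (p ^ R) ^ 2 := by ring
    have e3 : x ^ (R + 1 + 1) = x * x * x ^ R := by ring
    have e4 : x ^ (R + 1) = x * x ^ R := by ring
    rw [e1] at hE2
    rw [e1, e2, e3, e4]
    generalize p ^ R = y at *
    generalize x ^ R = z at *
    generalize hu : 1 - x * E * (p * y) = u at *
    field_simp
    rw [← hu]
    ring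

/-- The terminating very-well-poised `₆φ₅` summation. -/
lemma vwp_terminating {x p B C : ℂ} (hp : ‖p‖ < 1)
    (hB : ∀ n, qPoch (x * B) p n ≠ 0) (hC : ∀ n, qPoch (x * C) p n ≠ 0)
    (hx : ∀ n, qPoch x p n ≠ 0) (n : ℕ) {R : ℕ} (hR : n ≤ R) :
    qPoch (x * B) p n * qPoch (x * C) p n *
        (1 + ∑ r ∈ Finset.range R, vwpTerm x p B C (p ^ n) r)
      = qPoch x p n * qPoch (x * B * C) p n := by
  induction n with
  | zero => simp [vwpTerm, altPoch_one_succ]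
  | succ n ih =>
    have h := vwp_partial_contiguous hp hB hC (qPoch_shift_ne_zero hx n) R
    -- No limit is needed here: the numerator of the certificate contains the factor p^n - p^n.
    have h0 : vwpCert x p B C (p ^ n) R = 0 := by
      simp [vwpCert, altPoch_pow_eq_zero p (show n < R by lia)]
    rw [h0, neg_zero, sub_eq_zero, ← pow_succ'] at h
    have ih := ih (by lia)
    rw [qPoch_succ, qPoch_succ, qPoch_succ, qPoch_succ]
    linear_combination (1 - x * p ^ n) * (1 - x * B * C * p ^ n) * ih
      - qPoch (x * B) p n * qPoch (x * C) p n * h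

lemma vwpTerm_bound {x p B C E : ℂ} (hp : ‖p‖ < 1) (hx : ‖x‖ < 1) (hB : ‖B‖ ≤ 1)
    (hC : ‖C‖ ≤ 1) (hE : ‖E‖ ≤ 1) :
    ∃ M : ℝ, ∀ k r, ‖vwpTerm x p B C (E * p ^ k) r‖ ≤ M * ‖x‖ ^ (r + 1) ∧
      ‖vwpCert x p B C (E * p ^ k) r‖ ≤ M * ‖x‖ ^ (r + 1) := by
  have hlt : ∀ a : ℂ, ‖a‖ ≤ 1 → ‖x * a‖ < 1 := fun a ha => by
    rw [norm_mul]
    exact mul_lt_one_of_nonneg_of_lt_one_left (norm_nonneg _) hx ha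
  obtain ⟨M₀, h0⟩ := exists_bound_altPoch hp
  obtain ⟨M₁, h1⟩ := exists_bound_qPoch x hp
  obtain ⟨M₂, h2⟩ := exists_bound_inv_qPoch hp (fun n => qPoch_ne_zero hp hp n)
  obtain ⟨M₃, h3⟩ := exists_bound_inv_qPoch hp (fun n => qPoch_ne_zero (hlt B hB) hp n)
  obtain ⟨M₄, h4⟩ := exists_bound_inv_qPoch hp (fun n => qPoch_ne_zero (hlt C hC) hp n)
  obtain ⟨M₅, h5⟩ := exists_bound_inv_qPoch_shift hp (fun n => qPoch_ne_zero (hlt E hE) hp n)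
  have m0 := (norm_nonneg _).trans (h0 0 (by simp) 0)
  have m1 := (norm_nonneg _).trans (h1 0)
  have m2 := (norm_nonneg _).trans (h2 0)
  have m3 := (norm_nonneg _).trans (h3 0)
  have m4 := (norm_nonneg _).trans (h4 0)
  have m5 := (norm_nonneg _).trans (h5 0 0)
  have hEk : ∀ k, ‖E * p ^ k‖ ≤ 1 := fun k => by
    rw [norm_mul, norm_pow]
    exact mul_le_one₀ hE (by positivity) (pow_le_one₀ (norm_nonneg _) hp.le)
  have hone : ∀ a : ℂ, ‖a‖ ≤ 1 → ‖1 - a‖ ≤ 2 := fun a ha => by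
    refine (norm_sub_le _ _).trans ?_
    rw [norm_one]
    linarith
  refine ⟨2 * M₁ * (M₀ * M₀ * M₀) * (M₂ * M₃ * M₄ * M₅), fun k r => ⟨?_, ?_⟩⟩
  · have e : vwpTerm x p B C (E * p ^ k) r
        = (1 - x * p ^ (2 * r + 1)) * qPoch x p r *
          (altPoch B p (r + 1) * altPoch C p (r + 1) * altPoch (E * p ^ k) p (r + 1)) *
          ((qPoch p p (r + 1))⁻¹ * (qPoch (x * B) p (r + 1))⁻¹ * (qPoch (x * C) p (r + 1))⁻¹ *
            (qPoch (x * E * p ^ k) p (r + 1))⁻¹) * x ^ (r + 1) := by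
      rw [vwpTerm, mul_assoc x E, div_eq_mul_inv]
      simp only [mul_inv]
      ring
    have hx' : ‖1 - x * p ^ (2 * r + 1)‖ ≤ 2 := by
      refine hone _ ?_
      rw [norm_mul, norm_pow]
      exact mul_le_one₀ hx.le (by positivity) (pow_le_one₀ (norm_nonneg _) hp.le)
    rw [e]
    simp only [norm_mul, norm_pow]
    gcongr
    exacts [h1 _, h0 _ hB _, h0 _ hC _, by simpa using h0 _ (hEk k) _, h2 _, h3 _, h4 _,
      by simpa using h5 _ _]
  · have e : vwpCert x p B C (E * p ^ k) r
        = (1 - x * (E * p ^ k)) * qPoch x p r *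
          (altPoch B p (r + 1) * altPoch C p (r + 1) * altPoch (E * p ^ k) p r) *
          ((qPoch p p r)⁻¹ * (qPoch (x * B) p r)⁻¹ * (qPoch (x * C) p r)⁻¹ *
            (qPoch (x * E * p ^ k) p (r + 1))⁻¹) * ((E * p ^ k) * x ^ (r + 1)) := by
      rw [vwpCert, mul_assoc x E, div_eq_mul_inv]
      simp only [mul_inv]
      ring
    have hx' : ‖1 - x * (E * p ^ k)‖ ≤ 2 := hone _ (hlt _ (hEk k)).le
    have hx2 : ‖E * p ^ k * x ^ (r + 1)‖ ≤ ‖x‖ ^ (r + 1) := by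
      rw [norm_mul, norm_pow x]
      exact mul_le_of_le_one_left (by positivity) (hEk k)
    rw [e, norm_mul _ (E * p ^ k * x ^ (r + 1)), norm_mul, norm_mul, norm_mul]
    simp only [norm_mul (altPoch B p (r + 1) * altPoch C p (r + 1)),
      norm_mul (altPoch B p (r + 1)), norm_mul ((qPoch p p r)⁻¹ * (qPoch (x * B) p r)⁻¹ *
        (qPoch (x * C) p r)⁻¹), norm_mul ((qPoch p p r)⁻¹ * (qPoch (x * B) p r)⁻¹),
      norm_mul ((qPoch p p r)⁻¹)]
    gcongr
    exacts [h1 _, h0 _ hB _, h0 _ hC _, h0 _ (hEk k) _, h2 _, h3 _, h4 _, h5 _ _]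

lemma summable_geometric_succ_mul {x : ℂ} (hx : ‖x‖ < 1) (M : ℝ) :
    Summable fun r : ℕ => M * ‖x‖ ^ (r + 1) :=
  (((summable_geometric_of_lt_one (norm_nonneg _) hx).mul_left ‖x‖).congr
    fun r => by ring).mul_left M

lemma summable_vwpTerm {x p B C E : ℂ} (hp : ‖p‖ < 1) (hx : ‖x‖ < 1) (hB : ‖B‖ ≤ 1)
    (hC : ‖C‖ ≤ 1) (hE : ‖E‖ ≤ 1) : Summable (vwpTerm x p B C E) := by
  obtain ⟨M, hM⟩ := vwpTerm_bound hp hx hB hC hE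
  exact .of_norm_bounded (summable_geometric_succ_mul hx M)
    fun r => by simpa using (hM 0 r).1

lemma norm_mul_lt_one {x a : ℂ} (hx : ‖x‖ < 1) (ha : ‖a‖ ≤ 1) : ‖x * a‖ < 1 := by
  rw [norm_mul]
  exact mul_lt_one_of_nonneg_of_lt_one_left (norm_nonneg _) hx ha

lemma vwp_contiguous {x p B C E : ℂ} (hp : ‖p‖ < 1) (hx : ‖x‖ < 1) (hB : ‖B‖ ≤ 1)
    (hC : ‖C‖ ≤ 1) (hE : ‖E‖ ≤ 1) :
    (1 - x * E) * (1 - x * B * C * E) * (1 + ∑' r, vwpTerm x p B C E r)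
      = (1 - x * B * E) * (1 - x * C * E) * (1 + ∑' r, vwpTerm x p B C (E * p) r) := by
  obtain ⟨M, hM⟩ := vwpTerm_bound hp hx hB hC hE
  have hcert : Tendsto (fun R => -vwpCert x p B C E R) atTop (𝓝 0) := by
    rw [← neg_zero]
    refine (squeeze_zero_norm (fun R => ?_) (summable_geometric_succ_mul hx M).tendsto_atTop_zero).neg
    simpa using (hM 0 R).2
  have hpE : ‖E * p‖ ≤ 1 := by
    rw [norm_mul]
    exact mul_le_one₀ hE (norm_nonneg _) hp.le
  have h1 := ((summable_vwpTerm hp hx hB hC hE).hasSum.tendsto_sum_nat.const_add 1).const_mul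
    ((1 - x * E) * (1 - x * B * C * E))
  have h2 := ((summable_vwpTerm hp hx hB hC hpE).hasSum.tendsto_sum_nat.const_add 1).const_mul
    ((1 - x * B * E) * (1 - x * C * E))
  refine sub_eq_zero.1 (tendsto_nhds_unique (h1.sub h2) (hcert.congr fun R => ?_))
  rw [mul_comm E p]
  exact (vwp_partial_contiguous hp (qPoch_ne_zero (norm_mul_lt_one hx hB) hp)
    (qPoch_ne_zero (norm_mul_lt_one hx hC) hp) (qPoch_ne_zero (norm_mul_lt_one hx hE) hp) R).symm

lemma vwp_iterate {x p B C E : ℂ} (hp : ‖p‖ < 1) (hx : ‖x‖ < 1) (hB : ‖B‖ ≤ 1)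
    (hC : ‖C‖ ≤ 1) (hE : ‖E‖ ≤ 1) (k : ℕ) :
    qPoch (x * E) p k * qPoch (x * B * C * E) p k * (1 + ∑' r, vwpTerm x p B C E r)
      = qPoch (x * B * E) p k * qPoch (x * C * E) p k *
          (1 + ∑' r, vwpTerm x p B C (E * p ^ k) r) := by
  induction k with
  | zero => simp
  | succ k ih =>
    have hEk : ‖E * p ^ k‖ ≤ 1 := by
      rw [norm_mul, norm_pow]
      exact mul_le_one₀ hE (by positivity) (pow_le_one₀ (norm_nonneg _) hp.le)
    have h := vwp_contiguous hp hx hB hC hEk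
    rw [mul_assoc E, ← pow_succ] at h
    simp only [qPoch_succ]
    linear_combination (1 - x * E * p ^ k) * (1 - x * B * C * E * p ^ k) * ih
      + qPoch (x * B * E) p k * qPoch (x * C * E) p k * h

lemma continuous_altPoch (p : ℂ) (n : ℕ) : Continuous fun a => altPoch a p n := by
  unfold altPoch
  fun_prop

lemma continuous_qPoch (p : ℂ) (n : ℕ) : Continuous fun a => qPoch a p n := by
  unfold qPoch
  fun_prop

lemma tendsto_tsum_vwpTerm {x p B C E : ℂ} (hp : ‖p‖ < 1) (hx : ‖x‖ < 1) (hB : ‖B‖ ≤ 1)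
    (hC : ‖C‖ ≤ 1) (hE : ‖E‖ ≤ 1) :
    Tendsto (fun k : ℕ => ∑' r, vwpTerm x p B C (E * p ^ k) r) atTop
      (𝓝 (∑' r, vwpTerm x p B C 0 r)) := by
  obtain ⟨M, hM⟩ := vwpTerm_bound hp hx hB hC hE
  refine tendsto_tsum_of_dominated_convergence (summable_geometric_succ_mul hx M) (fun r => ?_)
    (.of_forall fun k r => (hM k r).1)
  have hlim : Tendsto (fun k : ℕ => E * p ^ k) atTop (𝓝 0) := by
    simpa using (tendsto_pow_atTop_nhds_zero_of_norm_lt_one hp).const_mul E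
  have hcont : ContinuousAt (fun e => vwpTerm x p B C e r) 0 := by
    unfold vwpTerm
    refine ContinuousAt.div ?_ ?_ ?_
    · exact (continuous_const.mul (continuous_const.mul (continuous_altPoch p _))).continuousAt
    · exact (continuous_const.mul ((continuous_qPoch p _).comp
        (continuous_const.mul continuous_id))).continuousAt
    · simp [qPoch_ne_zero hp hp, qPoch_ne_zero (norm_mul_lt_one hx hB) hp,
        qPoch_ne_zero (norm_mul_lt_one hx hC) hp]
  exact hcont.tendsto.comp hlim

/-- The nonterminating `₆φ₅` summation, before evaluating the value at `E = 0`. -/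
lemma vwp_limit {x p B C E a b c d : ℂ} (hp : ‖p‖ < 1) (hx : ‖x‖ < 1) (hB : ‖B‖ ≤ 1)
    (hC : ‖C‖ ≤ 1) (hE : ‖E‖ ≤ 1)
    (ha : Tendsto (qPoch (x * E) p) atTop (𝓝 a))
    (hb : Tendsto (qPoch (x * B * C * E) p) atTop (𝓝 b))
    (hc : Tendsto (qPoch (x * B * E) p) atTop (𝓝 c))
    (hd : Tendsto (qPoch (x * C * E) p) atTop (𝓝 d)) :
    a * b * (1 + ∑' r, vwpTerm x p B C E r) = c * d * (1 + ∑' r, vwpTerm x p B C 0 r) :=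
  tendsto_nhds_unique ((ha.mul hb).mul_const _)
    (((hc.mul hd).mul ((tendsto_tsum_vwpTerm hp hx hB hC hE).const_add 1)).congr
      fun k => (vwp_iterate hp hx hB hC hE k).symm)

/-- At E = 1 every summand contains the factor 1 - 1, so the left-hand series is 1 and the value at
E = 0 can be read off. -/
lemma vwp_limit_one {x p B C a b c d : ℂ} (hp : ‖p‖ < 1) (hx : ‖x‖ < 1) (hB : ‖B‖ ≤ 1)
    (hC : ‖C‖ ≤ 1)
    (ha : Tendsto (qPoch x p) atTop (𝓝 a))
    (hb : Tendsto (qPoch (x * B * C) p) atTop (𝓝 b))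
    (hc : Tendsto (qPoch (x * B) p) atTop (𝓝 c))
    (hd : Tendsto (qPoch (x * C) p) atTop (𝓝 d)) :
    a * b = c * d * (1 + ∑' r, vwpTerm x p B C 0 r) := by
  have h := vwp_limit (E := 1) hp hx hB hC (by simp) (by simpa using ha) (by simpa using hb)
    (by simpa using hc) (by simpa using hd)
  simpa [vwpTerm, altPoch_one_succ] using h

/-! ### Gauss's theta series and the two-squares formula -/

lemma altPoch_neg_one_mul (p : ℂ) (n : ℕ) :
    altPoch (-1) p (n + 1) * (1 + p ^ (n + 1)) = (-1) ^ (n + 1) * 2 * qPoch (-p) p (n + 1) := by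
  induction n with
  | zero => simp [altPoch_succ, qPoch_succ]; ring
  | succ n ih =>
    rw [altPoch_succ, qPoch_succ]
    linear_combination -(1 + p ^ (n + 2)) * ih

/-- At x = p, i.e. a = 1, the very-well-poised factor 1 - p^(2r+2) splits and cancels the (p;p)
quotient. -/
lemma vwpTerm_self {p B C E : ℂ} (hp : ‖p‖ < 1) (r : ℕ) :
    vwpTerm p p B C E r = (1 + p ^ (r + 1)) * p ^ (r + 1) *
      (altPoch B p (r + 1) * altPoch C p (r + 1) * altPoch E p (r + 1)) /
      (qPoch (p * B) p (r + 1) * qPoch (p * C) p (r + 1) * qPoch (p * E) p (r + 1)) := by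
  have h1 := qPoch_ne_zero hp hp r
  have h2 := one_sub_mul_pow_ne_zero hp hp r
  rw [vwpTerm, qPoch_succ p p r]
  have e : 1 - p * p ^ (2 * r + 1) = (1 - p * p ^ r) * (1 + p ^ (r + 1)) := by ring
  rw [e]
  field_simp

lemma two_mul_choose_two_add (r : ℕ) : 2 * r.choose 2 + r = r ^ 2 := by
  induction r with
  | zero => simp
  | succ r ih => rw [Nat.choose_succ_succ' r 1, Nat.choose_one_right]; linarith

/-- With n = r + 1, the two zero parameters contribute p^(n(n-1)), which with p^n makes p^(n^2). -/
lemma vwpTerm_gauss {p : ℂ} (hp : ‖p‖ < 1) (r : ℕ) :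
    vwpTerm p p (-1) 0 0 r = 2 * ((-1) ^ (r + 1) * p ^ ((r + 1) ^ 2)) := by
  have h1 : qPoch (-p) p (r + 1) ≠ 0 := qPoch_ne_zero (by simpa using hp) hp _
  have h := altPoch_neg_one_mul p r
  rw [vwpTerm_self hp, altPoch_zero_left, mul_neg_one, mul_zero, qPoch_zero_left, mul_one, mul_one,
    div_eq_iff h1, ← two_mul_choose_two_add (r + 1), pow_add, two_mul, pow_add]
  have hs : ((-1 : ℂ) ^ (r + 1)) * (-1) ^ (r + 1) = 1 := by rw [← mul_pow]; simp
  linear_combination (p ^ ((r + 1).choose 2)) ^ 2 * p ^ (r + 1) * h +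
    (1 + p ^ (r + 1)) * p ^ (r + 1) * altPoch (-1) p (r + 1) *
    (p ^ ((r + 1).choose 2)) ^ 2 * hs

/-- Since (i - p^k)(-i - p^k) = 1 + p^(2k), both sides are products of the same factors shifted by
one place; the k = 0 factor is the 2. -/
lemma altPoch_I_mul (p : ℂ) (n : ℕ) :
    altPoch Complex.I p (n + 1) * altPoch (-Complex.I) p (n + 1) * (1 + p ^ (2 * (n + 1)))
      = 2 * (qPoch (p * Complex.I) p (n + 1) * qPoch (p * -Complex.I) p (n + 1)) := by
  have hI := Complex.I_sq
  induction n with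
  | zero =>
    simp only [altPoch_succ, qPoch_succ, altPoch_zero, qPoch_zero, zero_add, pow_zero, one_mul,
      mul_one]
    linear_combination (-1 - p ^ 2 + 2 * p ^ 2) * hI
  | succ n ih =>
    rw [altPoch_succ, qPoch_succ, altPoch_succ (-Complex.I), qPoch_succ (p * -Complex.I)]
    have e1 : (Complex.I - p ^ (n + 1)) * (-Complex.I - p ^ (n + 1)) = 1 + p ^ (2 * (n + 1)) := by
      linear_combination -hI
    have e2 : (1 - p * Complex.I * p ^ (n + 1)) * (1 - p * -Complex.I * p ^ (n + 1))
        = 1 + p ^ (2 * (n + 2)) := by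
      linear_combination -p ^ (2 * (n + 2)) * hI
    calc _ = altPoch Complex.I p (n + 1) * altPoch (-Complex.I) p (n + 1) *
          ((Complex.I - p ^ (n + 1)) * (-Complex.I - p ^ (n + 1))) *
          (1 + p ^ (2 * (n + 2))) := by ring
      _ = 2 * (qPoch (p * Complex.I) p (n + 1) * qPoch (p * -Complex.I) p (n + 1)) *
          (1 + p ^ (2 * (n + 2))) := by rw [e1, ih]
      _ = _ := by rw [← e2]; ring

lemma one_add_pow_ne_zero {p : ℂ} (hp : ‖p‖ < 1) (n : ℕ) : 1 + p ^ (n + 1) ≠ 0 := by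
  have := one_sub_mul_pow_ne_zero (a := -p) (by simpa using hp) hp n
  rwa [show 1 - -p * p ^ n = 1 + p ^ (n + 1) by ring] at this

lemma vwpTerm_lambert {p : ℂ} (hp : ‖p‖ < 1) (r : ℕ) :
    vwpTerm p p Complex.I (-Complex.I) (-1) r
      = 4 * ((-p) ^ (r + 1) / (1 + p ^ (2 * (r + 1)))) := by
  have h1 : qPoch (-p) p (r + 1) ≠ 0 := qPoch_ne_zero (by simpa using hp) hp _
  have h2 : qPoch (p * Complex.I) p (r + 1) ≠ 0 := qPoch_ne_zero (by simpa using hp) hp _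
  have h3 : qPoch (p * -Complex.I) p (r + 1) ≠ 0 := qPoch_ne_zero (by simpa using hp) hp _
  have h4 : 1 + p ^ (2 * (r + 1)) ≠ 0 := one_add_pow_ne_zero hp (2 * r + 1)
  have e1 := altPoch_neg_one_mul p r
  have e2 := altPoch_I_mul p r
  rw [vwpTerm_self hp, mul_neg_one, ← mul_div_assoc, div_eq_div_iff (mul_ne_zero (mul_ne_zero h2 h3) h1) h4,
    neg_pow p]
  calc _ = p ^ (r + 1) * (altPoch (-1) p (r + 1) * (1 + p ^ (r + 1))) *
        (altPoch Complex.I p (r + 1) * altPoch (-Complex.I) p (r + 1) *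
          (1 + p ^ (2 * (r + 1)))) := by ring
    _ = _ := by rw [e1, e2]; ring

/-- Gauss's sum and the Lambert series `∑ (-p)^n / (1 + p^(2n))` are related by squaring. -/
lemma gauss_sq_eq_lambert {p : ℂ} (hp : ‖p‖ < 1) :
    (1 + ∑' r : ℕ, 2 * ((-1) ^ (r + 1) * p ^ ((r + 1) ^ 2))) ^ 2
      = 1 + ∑' r : ℕ, 4 * ((-p) ^ (r + 1) / (1 + p ^ (2 * (r + 1)))) := by
  simp only [← vwpTerm_gauss hp, ← vwpTerm_lambert hp]
  obtain ⟨a, ha, -⟩ := exists_tendsto_qPoch p hp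
  obtain ⟨b, hb, hb0⟩ := exists_tendsto_qPoch (-p) hp
  obtain ⟨c, hc, hc0⟩ := exists_tendsto_qPoch (p * Complex.I) hp
  obtain ⟨d, hd, hd0⟩ := exists_tendsto_qPoch (p * -Complex.I) hp
  have hb0 := hb0 (qPoch_ne_zero (by simpa using hp) hp)
  have hc0 := hc0 (qPoch_ne_zero (by simpa using hp) hp)
  have hd0 := hd0 (qPoch_ne_zero (by simpa using hp) hp)
  have h0 : Tendsto (qPoch 0 p) atTop (𝓝 1) := by
    simp only [funext (qPoch_zero_left p)]
    exact tendsto_const_nhds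
  have hI : p * Complex.I * -Complex.I = p := by linear_combination -p * Complex.I_mul_I
  have g := vwp_limit_one (x := p) (p := p) (B := -1) (C := 0) hp hp (by simp) (by simp) ha
    (by simpa using h0) (by simpa using hb) (by simpa using h0)
  have l1 := vwp_limit_one (x := p) (p := p) (B := Complex.I) (C := -Complex.I) hp hp (by simp)
    (by simp) ha (by rwa [hI]) hc hd
  have l2 := vwp_limit (x := p) (p := p) (B := Complex.I) (C := -Complex.I) (E := -1) hp hp
    (by simp) (by simp) (by simp) (by simpa using hb) (by rw [hI]; simpa using hb)
    (c := d) (d := c) (by simpa using hd) (by simpa using hc)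
  generalize 1 + ∑' r, vwpTerm p p (-1) 0 0 r = S at *
  generalize 1 + ∑' r, vwpTerm p p Complex.I (-Complex.I) (-1) r = T at *
  generalize 1 + ∑' r, vwpTerm p p Complex.I (-Complex.I) 0 r = U at *
  have hbb : b * b ≠ 0 := mul_ne_zero hb0 hb0
  refine mul_left_cancel₀ hbb ?_
  -- The three evaluations read a = bS, a^2 = cdU and b^2 T = cdU, whence b^2 S^2 = b^2 T.
  linear_combination (-(a + b * S)) * g + l1 - l2

lemma summable_sq_pow {q : ℂ} (hq : ‖q‖ < 1) : Summable fun r : ℕ => q ^ ((r + 1) ^ 2) := by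
  refine .of_norm_bounded (summable_geometric_succ_mul hq 1) fun r => ?_
  rw [norm_pow, one_mul]
  exact pow_le_pow_of_le_one (norm_nonneg _) hq.le (by nlinarith)

lemma hasSum_theta {q : ℂ} (hq : ‖q‖ < 1) :
    HasSum (fun n : ℤ => q ^ (n ^ 2)) (1 + 2 * ∑' r : ℕ, q ^ ((r + 1) ^ 2)) := by
  have h := (summable_sq_pow hq).hasSum
  have h1 : HasSum (fun n : ℕ => q ^ ((n : ℤ) ^ 2)) (1 + ∑' r : ℕ, q ^ ((r + 1) ^ 2)) := by
    rw [← hasSum_nat_add_iff' 1]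
    simp only [Finset.range_one, Finset.sum_singleton, Nat.cast_zero, ne_eq, OfNat.ofNat_ne_zero,
      not_false_eq_true, zero_pow, zpow_zero, add_sub_cancel_left]
    exact_mod_cast h
  have h2 : HasSum (fun n : ℕ => q ^ ((-(n + 1 : ℤ)) ^ 2)) (∑' r : ℕ, q ^ ((r + 1) ^ 2)) := by
    simp only [neg_sq]
    exact_mod_cast h
  convert HasSum.of_nat_of_neg_add_one (f := fun n : ℤ => q ^ (n ^ 2)) h1 h2 using 1
  ring

/-- Taken at p = -q: n and n^2 have the same parity, so the signs cancel. -/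
lemma ramanujanPhi_sq {q : ℂ} (hq : ‖q‖ < 1) :
    ramanujanPhi q ^ 2 = 1 + ∑' r : ℕ, 4 * (q ^ (r + 1) / (1 + q ^ (2 * (r + 1)))) := by
  have h := gauss_sq_eq_lambert (p := -q) (by simpa using hq)
  rw [ramanujanPhi, (hasSum_theta hq).tsum_eq, ← tsum_mul_left]
  simp only [neg_neg] at h
  have e1 : ∀ r : ℕ, (-1) ^ (r + 1) * (-q) ^ ((r + 1) ^ 2) = q ^ ((r + 1) ^ 2) := fun r => by
    have : Even (r + 1 + (r + 1) ^ 2) := by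
      rw [show r + 1 + (r + 1) ^ 2 = (r + 1) * (r + 1 + 1) by ring]
      exact Nat.even_mul_succ_self _
    rw [neg_pow q, ← mul_assoc, ← pow_add, this.neg_one_pow, one_mul]
  have e2 : ∀ r : ℕ, (-q) ^ (2 * (r + 1)) = q ^ (2 * (r + 1)) := fun r =>
    (even_two_mul _).neg_pow q
  simpa only [e1, e2] using h

/-! ### Lambert series and their first expansion -/

/-- The Lambert series `∑_{m ≥ 1} x^m / (1 - p^m)`. -/
noncomputable def lambert (x p : ℂ) : ℂ := ∑' m : ℕ, x ^ (m + 1) / (1 - p ^ (m + 1))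

lemma norm_inv_one_sub_pow_le {p : ℂ} (hp : ‖p‖ < 1) (m : ℕ) :
    ‖(1 - p ^ (m + 1))⁻¹‖ ≤ (1 - ‖p‖)⁻¹ := by
  rw [norm_inv]
  refine inv_anti₀ (by linarith) ?_
  have h1 : ‖p ^ (m + 1)‖ ≤ ‖p‖ := by
    rw [norm_pow]
    exact pow_le_of_le_one (norm_nonneg _) hp.le (by simp)
  have h2 := norm_sub_norm_le (1 : ℂ) (p ^ (m + 1))
  rw [norm_one] at h2
  linarith

lemma norm_lambert_term_le {x p : ℂ} (hp : ‖p‖ < 1) (m : ℕ) :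
    ‖x ^ (m + 1) / (1 - p ^ (m + 1))‖ ≤ (1 - ‖p‖)⁻¹ * ‖x‖ ^ (m + 1) := by
  rw [div_eq_mul_inv, norm_mul, norm_pow, mul_comm]
  gcongr
  exact norm_inv_one_sub_pow_le hp m

lemma summable_lambert {x p : ℂ} (hp : ‖p‖ < 1) (hx : ‖x‖ < 1) :
    Summable fun m : ℕ => x ^ (m + 1) / (1 - p ^ (m + 1)) :=
  .of_norm_bounded (summable_geometric_succ_mul hx _) (norm_lambert_term_le hp)

lemma norm_pow_lt_one {q : ℂ} (hq : ‖q‖ < 1) (n : ℕ) : ‖q ^ (n + 1)‖ < 1 := by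
  rw [norm_pow]
  exact pow_lt_one₀ (norm_nonneg _) hq (by simp)

/-- The two-squares theorem in Lambert series form. -/
lemma ramanujanPhi_sq_eq_lambert {q : ℂ} (hq : ‖q‖ < 1) :
    ramanujanPhi q ^ 2 = 1 + 4 * (lambert q (q ^ 4) - lambert (q ^ 3) (q ^ 4)) := by
  have h4 : ‖q ^ 4‖ < 1 := norm_pow_lt_one hq 3
  rw [ramanujanPhi_sq hq, tsum_mul_left, lambert, lambert,
    ← (summable_lambert h4 hq).tsum_sub (summable_lambert h4 (norm_pow_lt_one hq 2))]
  -- Termwise, 1/(1 + q^(2n)) = (1 - q^(2n))/(1 - q^(4n)).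
  congr 3 with r
  have h1 : 1 + q ^ (2 * (r + 1)) ≠ 0 := one_add_pow_ne_zero hq (2 * r + 1)
  have h2 : 1 - (q ^ 4) ^ (r + 1) ≠ 0 := by
    have := one_sub_mul_pow_ne_zero h4 h4 r
    rwa [← pow_succ'] at this
  rw [← sub_div, div_eq_div_iff h1 h2]
  ring

/-- The term of index `n + 1` of the series
`∑_{n ≥ 1} (-1)^n p^(n(n-1)/2) x^n / ((x;p)_n (1 - p^n)) = -∑_{m ≥ 1} x^m / (1 - p^m)`. -/
noncomputable def lambertTerm (x p : ℂ) (n : ℕ) : ℂ :=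
  (-1) ^ (n + 1) * p ^ ((n + 1).choose 2) * x ^ (n + 1) /
    (qPoch x p (n + 1) * (1 - p ^ (n + 1)))

lemma pow_choose_two_succ (p : ℂ) (n : ℕ) :
    p ^ ((n + 1).choose 2) = p ^ n * p ^ (n.choose 2) := by
  rw [Nat.choose_succ_succ' n 1, Nat.choose_one_right, pow_add]

lemma one_sub_pow_succ_ne_zero {p : ℂ} (hp : ‖p‖ < 1) (n : ℕ) : 1 - p ^ (n + 1) ≠ 0 := by
  rw [pow_succ']
  exact one_sub_mul_pow_ne_zero hp hp n

lemma lambertTerm_bound {x p : ℂ} (hp : ‖p‖ < 1) (hx : ‖x‖ < 1) :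
    ∃ M : ℝ, ∀ k n, ‖lambertTerm (x * p ^ k) p n‖
      ≤ M * ‖p‖ ^ ((n + 1).choose 2) * ‖x * p ^ k‖ ^ (n + 1) := by
  obtain ⟨M, hM⟩ := exists_bound_inv_qPoch_shift hp (fun n => qPoch_ne_zero hx hp n)
  refine ⟨M * (1 - ‖p‖)⁻¹, fun k n => ?_⟩
  have e : lambertTerm (x * p ^ k) p n = (-1) ^ (n + 1) * ((qPoch (x * p ^ k) p (n + 1))⁻¹ *
      (1 - p ^ (n + 1))⁻¹ * p ^ ((n + 1).choose 2) * (x * p ^ k) ^ (n + 1)) := by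
    rw [lambertTerm, div_eq_mul_inv, mul_inv]; ring
  have m0 := (norm_nonneg _).trans (hM 0 0)
  rw [e, norm_mul, norm_pow, norm_neg, norm_one, one_pow, one_mul, norm_mul, norm_mul, norm_mul,
    norm_pow p, norm_pow (x * p ^ k)]
  gcongr
  exacts [hM _ _, norm_inv_one_sub_pow_le hp n]

lemma norm_mul_pow_pow_le {x p : ℂ} (hp : ‖p‖ < 1) (k n : ℕ) :
    ‖x * p ^ k‖ ^ (n + 1) ≤ ‖p‖ ^ k * ‖x‖ ^ (n + 1) := by
  rw [norm_mul, mul_pow, mul_comm, norm_pow]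
  gcongr
  exact pow_le_of_le_one (by positivity) (pow_le_one₀ (norm_nonneg _) hp.le) (by simp)

/-- The factor |p|^k forces the whole series at x p^k to 0 as k grows. -/
lemma lambertTerm_bound' {x p : ℂ} (hp : ‖p‖ < 1) (hx : ‖x‖ < 1) :
    ∃ M : ℝ, ∀ k n, ‖lambertTerm (x * p ^ k) p n‖ ≤ M * ‖x‖ ^ (n + 1) * ‖p‖ ^ k := by
  obtain ⟨M, hM⟩ := lambertTerm_bound hp hx
  refine ⟨|M|, fun k n => (hM k n).trans ?_⟩
  calc M * ‖p‖ ^ ((n + 1).choose 2) * ‖x * p ^ k‖ ^ (n + 1)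
      ≤ |M| * 1 * (‖p‖ ^ k * ‖x‖ ^ (n + 1)) := by
        gcongr
        · exact le_abs_self _
        · exact pow_le_one₀ (norm_nonneg _) hp.le
        · exact norm_mul_pow_pow_le hp k n
    _ = _ := by ring

lemma summable_lambertTerm {x p : ℂ} (hp : ‖p‖ < 1) (hx : ‖x‖ < 1) :
    Summable (lambertTerm x p) := by
  obtain ⟨M, hM⟩ := lambertTerm_bound' hp hx
  exact .of_norm_bounded (summable_geometric_succ_mul hx M) fun n => by simpa using hM 0 n

/-- The difference under x ↦ xp telescopes; the boundary term dies in the limit, leaving -x/(1-x),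
the negative of the corresponding difference for L. -/
lemma sum_lambertTerm_sub {x p : ℂ} (hp : ‖p‖ < 1) (hx : ‖x‖ < 1) (N : ℕ) :
    ∑ n ∈ Finset.range N, (lambertTerm x p n - lambertTerm (x * p) p n)
      = -x / (1 - x) - (1 - p ^ (N + 1)) * lambertTerm x p N := by
  induction N with
  | zero =>
    have h1 : 1 - p ≠ 0 := by simpa using one_sub_pow_succ_ne_zero hp 0
    have h2 : 1 - x ≠ 0 := by simpa using one_sub_mul_pow_ne_zero hx hp 0
    simp only [Finset.range_zero, Finset.sum_empty, lambertTerm, qPoch_succ, qPoch_zero]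
    simp
    field_simp
    ring
  | succ N ih =>
    rw [Finset.sum_range_succ, ih]
    have h0 := qPoch_ne_zero hx hp (N + 1)
    have h1 := one_sub_pow_succ_ne_zero hp N
    have h2 := one_sub_pow_succ_ne_zero hp (N + 1)
    have h3 := one_sub_mul_pow_ne_zero hx hp (N + 1)
    have h4 : 1 - x ≠ 0 := by simpa using one_sub_mul_pow_ne_zero hx hp 0
    have e : qPoch (x * p) p (N + 1)
        = qPoch x p (N + 1) * (1 - x * p ^ (N + 1)) / (1 - x) := by
      rw [← qPoch_succ, qPoch_succ' x]
      field_simp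
    simp only [lambertTerm, e]
    rw [qPoch_succ x p (N + 1), pow_choose_two_succ p (N + 1), mul_pow x p (N + 1)]
    generalize qPoch x p (N + 1) = P at *
    generalize p ^ ((N + 1).choose 2) = c at *
    generalize hu : 1 - p ^ (N + 1 + 1) = u at *
    field_simp
    ring

lemma lambert_sub {x p : ℂ} (hp : ‖p‖ < 1) (hx : ‖x‖ < 1) :
    lambert x p - lambert (x * p) p = x / (1 - x) := by
  rw [lambert, lambert, ← (summable_lambert hp hx).tsum_sub
    (summable_lambert hp (norm_mul_lt_one hx hp.le))]
  have : ∀ m : ℕ, x ^ (m + 1) / (1 - p ^ (m + 1)) - (x * p) ^ (m + 1) / (1 - p ^ (m + 1))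
      = x * x ^ m := fun m => by
    have h1 := one_sub_pow_succ_ne_zero hp m
    field_simp
    ring
  simp only [this]
  rw [tsum_mul_left, tsum_geometric_of_norm_lt_one hx, div_eq_mul_inv]

lemma tsum_lambertTerm_sub {x p : ℂ} (hp : ‖p‖ < 1) (hx : ‖x‖ < 1) :
    ∑' n, lambertTerm x p n - ∑' n, lambertTerm (x * p) p n = -x / (1 - x) := by
  have h1 := summable_lambertTerm hp hx
  have h2 := summable_lambertTerm hp (norm_mul_lt_one hx hp.le)
  rw [← h1.tsum_sub h2]
  refine tendsto_nhds_unique (h1.sub h2).hasSum.tendsto_sum_nat ?_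
  simp only [sum_lambertTerm_sub hp hx]
  have hp0 : Tendsto (fun N : ℕ => 1 - p ^ (N + 1)) atTop (𝓝 (1 - 0)) :=
    ((tendsto_add_atTop_iff_nat 1).2 (tendsto_pow_atTop_nhds_zero_of_norm_lt_one hp)).const_sub 1
  simpa using (hp0.mul h1.tendsto_atTop_zero).const_sub (-x / (1 - x))

lemma hasSum_lambertTerm {x p : ℂ} (hp : ‖p‖ < 1) (hx : ‖x‖ < 1) :
    HasSum (lambertTerm x p) (-lambert x p) := by
  have hxk : ∀ k : ℕ, ‖x * p ^ k‖ < 1 := fun k => norm_mul_lt_one hx (by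
    rw [norm_pow]; exact pow_le_one₀ (norm_nonneg _) hp.le)
  have hstep : ∀ k : ℕ, ∑' n, lambertTerm (x * p ^ k) p n + lambert (x * p ^ k) p
      = ∑' n, lambertTerm x p n + lambert x p := fun k => by
    induction k with
    | zero => simp
    | succ k ih =>
      have h1 := tsum_lambertTerm_sub hp (hxk k)
      have h2 := lambert_sub hp (hxk k)
      rw [← ih, pow_succ, ← mul_assoc]
      linear_combination -h1 - h2
  have hp0 := tendsto_pow_atTop_nhds_zero_of_lt_one (norm_nonneg p) hp
  obtain ⟨M, hM⟩ := lambertTerm_bound' hp hx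
  have l1 : Tendsto (fun k : ℕ => ∑' n, lambertTerm (x * p ^ k) p n) atTop (𝓝 0) := by
    refine squeeze_zero_norm (fun k => tsum_of_norm_bounded
      ((summable_geometric_succ_mul hx M).mul_right (‖p‖ ^ k)).hasSum (hM k)) ?_
    simp only [tsum_mul_right]
    simpa using hp0.const_mul _
  have l2 : Tendsto (fun k : ℕ => lambert (x * p ^ k) p) atTop (𝓝 0) := by
    refine squeeze_zero_norm (fun k => tsum_of_norm_bounded
      ((summable_geometric_succ_mul hx (1 - ‖p‖)⁻¹).mul_right (‖p‖ ^ k)).hasSum fun n => ?_) ?_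
    · refine (norm_lambert_term_le hp n).trans ?_
      rw [mul_assoc, mul_comm (‖x‖ ^ (n + 1))]
      have : 0 ≤ (1 - ‖p‖)⁻¹ := inv_nonneg.2 (by linarith)
      gcongr
      exact norm_mul_pow_pow_le hp k n
    · simp only [tsum_mul_right]
      simpa using hp0.const_mul _
  have h0 : ∑' n, lambertTerm x p n + lambert x p = 0 := by
    refine tendsto_nhds_unique (f := fun _ : ℕ => _) (l := atTop) tendsto_const_nhds ?_
    simpa [hstep] using l1.add l2
  rw [← eq_neg_of_add_eq_zero_left h0]
  exact (summable_lambertTerm hp hx).hasSum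

/-! ### The ₁φ₁ summation -/

/-- The term of the `₁φ₁` series with numerator parameter `a` and denominator parameter `z a`. -/
noncomputable def phiTerm (a z p : ℂ) (m : ℕ) : ℂ :=
  (-1) ^ m * p ^ (m.choose 2) * z ^ m * qPoch a p m / (qPoch p p m * qPoch (z * a) p m)

/-- In the limit this says that replacing a by ap multiplies the sum by 1 - za. Starting from a = 1,
where only m = 0 survives, it evaluates the series at every a = p^r. -/
lemma sum_phiTerm_sub {a z p : ℂ} (hp : ‖p‖ < 1) (ha : ∀ n, qPoch (z * a) p n ≠ 0) (N : ℕ) :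
    ∑ m ∈ Finset.range (N + 1), (phiTerm (a * p) z p m - (1 - z * a) * phiTerm a z p m)
      = a * z * p ^ N * phiTerm (a * p) z p N := by
  have h1 : 1 - z * a ≠ 0 := by simpa [qPoch_succ] using ha 1
  induction N with
  | zero => simp [phiTerm]; ring
  | succ N ih =>
    rw [Finset.sum_range_succ, ih]
    have h2 := qPoch_ne_zero hp hp N
    have h3 := one_sub_mul_pow_ne_zero hp hp N
    have h4 := ha (N + 1)
    have h5 := ha (N + 2)
    have h5' : 1 - z * a * p ^ (N + 1) ≠ 0 := by
      rw [qPoch_succ] at h5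
      exact right_ne_zero_of_mul h5
    have h6 : qPoch (z * a * p) p N ≠ 0 := by
      rw [qPoch_succ'] at h4
      exact right_ne_zero_of_mul h4
    have e1 : qPoch (z * (a * p)) p (N + 1) = qPoch (z * a * p) p N * (1 - z * a * p ^ (N + 1)) := by
      rw [← mul_assoc, qPoch_succ]; ring
    simp only [phiTerm, e1]
    rw [qPoch_succ' (z * a), ← mul_assoc z a p, qPoch_succ' a, qPoch_succ p, qPoch_succ (a * p),
      pow_choose_two_succ]
    generalize qPoch (z * a * p) p N = P at *
    generalize qPoch (a * p) p N = Q at *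
    generalize qPoch p p N = S at *
    generalize p ^ (N.choose 2) = c at *
    have e2 : p ^ (N + 1) = p * p ^ N := by ring
    rw [e2] at h5' ⊢
    generalize p ^ N = y at *
    generalize hu : 1 - z * a * (p * y) = u at *
    generalize hv : 1 - z * a = v at *
    generalize hs : 1 - p * y = s at *
    field_simp
    rw [← hu, ← hs]
    ring

lemma summable_phiTerm {a z p : ℂ} (hp : ‖p‖ < 1) (ha : ∀ n, qPoch (z * a) p n ≠ 0) :
    Summable (phiTerm a z p) := by
  obtain ⟨M₁, h1⟩ := exists_bound_qPoch a hp
  obtain ⟨M₂, h2⟩ := exists_bound_inv_qPoch hp (fun n => qPoch_ne_zero hp hp n)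
  obtain ⟨M₃, h3⟩ := exists_bound_inv_qPoch hp ha
  refine .of_norm_bounded ((summable_pow_mul_pow_choose ‖z‖ (norm_nonneg p) hp).mul_left
    (M₁ * (M₂ * M₃))) fun m => ?_
  have e : phiTerm a z p m = (-1) ^ m * (qPoch a p m * ((qPoch p p m)⁻¹ * (qPoch (z * a) p m)⁻¹) *
      (z ^ m * p ^ (m.choose 2))) := by
    rw [phiTerm, div_eq_mul_inv, mul_inv]; ring
  have m1 := (norm_nonneg _).trans (h1 0)
  have m2 := (norm_nonneg _).trans (h2 0)
  rw [e, norm_mul, norm_pow, norm_neg, norm_one, one_pow, one_mul]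
  simp only [norm_mul, norm_pow]
  gcongr
  exacts [h1 m, h2 m, h3 m]

/-- The `₁φ₁` summation with numerator parameter a power of the base. -/
lemma tsum_phiTerm {z p : ℂ} (hp : ‖p‖ < 1) (hz : ∀ n, qPoch z p n ≠ 0) (r : ℕ) :
    ∑' m, phiTerm (p ^ r) z p m = qPoch z p r := by
  induction r with
  | zero =>
    rw [tsum_eq_single 0]
    · simp [phiTerm]
    · intro m hm
      obtain ⟨m, rfl⟩ := Nat.exists_eq_succ_of_ne_zero hm
      simp [phiTerm, qPoch_one_succ]
  | succ r ih =>
    have s1 := summable_phiTerm hp (qPoch_shift_ne_zero hz r)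
    have s2 := summable_phiTerm hp (qPoch_shift_ne_zero hz (r + 1))
    rw [pow_succ] at s2
    have hlim := ((s2.sub (s1.mul_left (1 - z * p ^ r))).hasSum.tendsto_sum_nat).comp
      (tendsto_add_atTop_nat 1)
    have h0 : Tendsto (fun N : ℕ => p ^ r * z * p ^ N * phiTerm (p ^ r * p) z p N) atTop (𝓝 0) := by
      simpa using ((tendsto_pow_atTop_nhds_zero_of_norm_lt_one hp).const_mul (p ^ r * z)).mul
        s2.tendsto_atTop_zero
    have h := tendsto_nhds_unique hlim (h0.congr fun N =>
      (sum_phiTerm_sub hp (qPoch_shift_ne_zero hz r) N).symm)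
    rw [s2.tsum_sub (s1.mul_left _), tsum_mul_left, ih] at h
    rw [pow_succ, qPoch_succ]
    linear_combination h

/-! ### Bailey's method: the two-parameter transformation -/

/-- The term of index `n + 1` of the series
`∑_{n ≥ 1} (p)_{n-1} (xBC)_n (-1)^n p^(n(n-1)/2) x^n / ((xB)_n (xC)_n (p)_n)`. -/
noncomputable def balancedTerm (x p B C : ℂ) (n : ℕ) : ℂ :=
  qPoch (x * B * C) p (n + 1) * (-1) ^ (n + 1) * p ^ ((n + 1).choose 2) * x ^ (n + 1) /
    (qPoch (x * B) p (n + 1) * qPoch (x * C) p (n + 1) * (1 - p ^ (n + 1)))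

/-- The term of index `r + 1` of the very-well-poised series obtained by Bailey's method from
`balancedTerm`. -/
noncomputable def wellPoisedTerm (x p B C : ℂ) (r : ℕ) : ℂ :=
  (1 - x * p ^ (2 * r + 1)) * p ^ (r * (r + 1)) * x ^ (2 * (r + 1)) *
      (altPoch B p (r + 1) * altPoch C p (r + 1)) /
    ((1 - p ^ (r + 1)) * (1 - x * p ^ r) * (qPoch (x * B) p (r + 1) * qPoch (x * C) p (r + 1)))

lemma lambertTerm_mul_vwpTerm_eq_zero (x p B C : ℂ) {n r : ℕ} (h : n < r) :
    lambertTerm x p n * vwpTerm x p B C (p ^ (n + 1)) r = 0 := by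
  simp [vwpTerm, altPoch_pow_eq_zero p (Nat.succ_lt_succ h)]

lemma pow_choose_two_add (p : ℂ) (a m : ℕ) :
    p ^ ((a + m).choose 2) = p ^ (a.choose 2) * p ^ (m.choose 2) * (p ^ a) ^ m := by
  induction m with
  | zero => simp
  | succ m ih => rw [← add_assoc, pow_choose_two_succ, ih, pow_choose_two_succ p m, pow_add, pow_succ (p ^ a)]; ring

/-- The cancellation pattern of the next lemma, with the shifted factorials as atoms; s is the sign
(-1)^(r+1), which occurs twice. -/
lemma mul_div_cancel_sign {s a b c d e f g h k l : ℂ} (u v : ℂ) (hs : s * s = 1) (hc : c ≠ 0) (hd : d ≠ 0)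
    (he : e ≠ 0) (hf : f ≠ 0) :
    (u * s * a * b / (c * d)) * (g * e * b * (s * a * (f * v * d) / h) / (f * k * (e * l / c)))
      = (g * (a * a) * (b * b) / k) * l⁻¹ * (u * v / h) := by
  have h1 : g * e * b * (s * a * (f * v * d) / h) / (f * k * (e * l / c))
      = g * b * (s * a * v * d * c) / (h * k * l) := by
    field_simp
  rw [h1]
  calc _ = (s * s) * (u * v * g * (a * a) * (b * b)) * (d / d) * (c / c) / (h * k * l) := by ring
    _ = _ := by rw [hs, div_self hd, div_self hc]; ring

/-- After n = m + r, all dependence on m is that of a ₁φ₁ term with numerator parameter p^(r+1) and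
denominator parameter x p^(2r+2). -/
lemma lambertTerm_mul_vwpTerm_add {x p B C : ℂ} (hp : ‖p‖ < 1) (hx : ‖x‖ < 1)
    (m r : ℕ) :
    lambertTerm x p (m + r) * vwpTerm x p B C (p ^ (m + r + 1)) r
      = wellPoisedTerm x p B C r * (qPoch (x * p ^ (r + 1)) p (r + 1))⁻¹ *
          phiTerm (p ^ (r + 1)) (x * p ^ (r + 1)) p m := by
  have hX := qPoch_ne_zero hx hp
  have hP := qPoch_ne_zero hp hp
  have eA : altPoch (p ^ (m + r + 1)) p (r + 1) = (-1) ^ (r + 1) * p ^ ((r + 1).choose 2) *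
      (qPoch p p r * qPoch (p ^ (r + 1)) p m * (1 - p ^ (m + r + 1))) / qPoch p p m := by
    rw [eq_div_iff (hP m), show m + r + 1 = r + 1 + m by ring, altPoch_pow_add,
      show r + 1 + m = r + m + 1 by ring, qPoch_succ, qPoch_add, ← pow_succ', ← pow_succ']
  have eX : qPoch x p (m + r + 1) * qPoch (x * p ^ (m + r + 1)) p (r + 1)
      = qPoch x p r * (1 - x * p ^ r) * (qPoch (x * p ^ (r + 1)) p (r + 1) *
        qPoch (x * p ^ (r + 1) * p ^ (r + 1)) p m) := by
    rw [← qPoch_succ, ← qPoch_add, ← qPoch_add, ← qPoch_add]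
    congr 1
    lia
  have eD : qPoch (x * p ^ (m + r + 1)) p (r + 1) = qPoch x p r * (1 - x * p ^ r) *
      (qPoch (x * p ^ (r + 1)) p (r + 1) * qPoch (x * p ^ (r + 1) * p ^ (r + 1)) p m) /
        qPoch x p (m + r + 1) := by
    rw [eq_div_iff (hX _), ← eX, mul_comm]
  have eC : p ^ ((m + r + 1).choose 2) = p ^ ((r + 1).choose 2) * p ^ (m.choose 2) *
      (p ^ (r + 1)) ^ m := by
    rw [show m + r + 1 = r + 1 + m by ring, pow_choose_two_add]
  have eR : p ^ (r * (r + 1)) = p ^ ((r + 1).choose 2) * p ^ ((r + 1).choose 2) := by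
    rw [← pow_add, ← two_mul]
    congr 1
    have := two_mul_choose_two_add (r + 1)
    nlinarith
  have eS : ((-1 : ℂ) ^ (r + 1)) * (-1) ^ (r + 1) = 1 := by rw [← mul_pow]; simp
  have n1 := hX r
  have n5 := hX (m + r + 1)
  have n7 := hP r
  have n9 := one_sub_pow_succ_ne_zero hp (m + r)
  have e1 : (-1 : ℂ) ^ (m + r + 1) = (-1) ^ m * (-1) ^ (r + 1) := by ring
  have e2 : x ^ (m + r + 1) = x ^ m * x ^ (r + 1) := by ring
  have e3 : x ^ (2 * (r + 1)) = x ^ (r + 1) * x ^ (r + 1) := by ring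
  rw [lambertTerm, vwpTerm, wellPoisedTerm, phiTerm, eA, eD, eC, eR, qPoch_succ p p r,
    ← pow_succ', mul_pow x _ m, e1, e2, e3]
  have key := mul_div_cancel_sign (a := p ^ ((r + 1).choose 2)) (b := x ^ (r + 1))
    (g := (1 - x * p ^ (2 * r + 1)) * (altPoch B p (r + 1) * altPoch C p (r + 1)))
    (h := qPoch p p m)
    (k := (1 - p ^ (r + 1)) * (1 - x * p ^ r) *
      (qPoch (x * B) p (r + 1) * qPoch (x * C) p (r + 1)))
    (l := qPoch (x * p ^ (r + 1)) p (r + 1) * qPoch (x * p ^ (r + 1) * p ^ (r + 1)) p m)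
    ((-1) ^ m * p ^ (m.choose 2) * (p ^ (r + 1)) ^ m * x ^ m)
    (qPoch (p ^ (r + 1)) p m) eS n5 n9 n1 n7
  clear eA eX eD eC eR e1 e2 e3
  generalize 1 - p ^ (m + r + 1) = t7 at *
  generalize 1 - p ^ (r + 1) = t8 at *
  generalize 1 - x * p ^ r = t9 at *
  generalize 1 - x * p ^ (2 * r + 1) = t13 at *
  simp only [div_eq_mul_inv, mul_inv, inv_inv] at key ⊢
  refine Eq.trans ?_ (key.trans ?_)
  · ac_rfl
  · ring

lemma vwpTerm_pow_bound {x p B C : ℂ} (hp : ‖p‖ < 1) (hx : ‖x‖ < 1)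
    (hB : ∀ n, qPoch (x * B) p n ≠ 0) (hC : ∀ n, qPoch (x * C) p n ≠ 0) :
    ∃ M : ℝ, ∀ n r, ‖vwpTerm x p B C (p ^ n) r‖
      ≤ M * (((‖B‖ + 1) * (‖C‖ + 1) * 2) ^ (r + 1) * ‖p‖ ^ ((r + 1).choose 2)) := by
  obtain ⟨M₁, h1⟩ := exists_bound_qPoch x hp
  obtain ⟨M₂, h2⟩ := exists_bound_inv_qPoch hp (fun n => qPoch_ne_zero hp hp n)
  obtain ⟨M₃, h3⟩ := exists_bound_inv_qPoch hp hB
  obtain ⟨M₄, h4⟩ := exists_bound_inv_qPoch hp hC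
  obtain ⟨M₅, h5⟩ := exists_bound_inv_qPoch_shift hp (fun n => qPoch_ne_zero hx hp n)
  have m1 := (norm_nonneg _).trans (h1 0)
  have m2 := (norm_nonneg _).trans (h2 0)
  have m3 := (norm_nonneg _).trans (h3 0)
  have m4 := (norm_nonneg _).trans (h4 0)
  have m5 := (norm_nonneg _).trans (h5 0 0)
  refine ⟨2 * M₁ * (M₂ * M₃ * M₄ * M₅), fun n r => ?_⟩
  have e : vwpTerm x p B C (p ^ n) r
      = (1 - x * p ^ (2 * r + 1)) * qPoch x p r *
        ((qPoch p p (r + 1))⁻¹ * (qPoch (x * B) p (r + 1))⁻¹ * (qPoch (x * C) p (r + 1))⁻¹ *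
          (qPoch (x * p ^ n) p (r + 1))⁻¹) * (x ^ (r + 1) *
        (altPoch B p (r + 1) * altPoch C p (r + 1) * altPoch (p ^ n) p (r + 1))) := by
    rw [vwpTerm, div_eq_mul_inv]
    simp only [mul_inv]
    ring
  have hx' : ‖1 - x * p ^ (2 * r + 1)‖ ≤ 2 := by
    have : ‖x * p ^ (2 * r + 1)‖ ≤ 1 := (norm_mul_lt_one hx (by
      rw [norm_pow]; exact pow_le_one₀ (norm_nonneg _) hp.le)).le
    refine (norm_sub_le _ _).trans ?_
    rw [norm_one]
    linarith
  have hg : ‖x ^ (r + 1) * (altPoch B p (r + 1) * altPoch C p (r + 1) *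
      altPoch (p ^ n) p (r + 1))‖
      ≤ ((‖B‖ + 1) * (‖C‖ + 1) * 2) ^ (r + 1) * ‖p‖ ^ ((r + 1).choose 2) := by
    rw [norm_mul, norm_mul, norm_mul, norm_pow]
    calc _ ≤ 1 * ((‖B‖ + 1) ^ (r + 1) * (‖C‖ + 1) ^ (r + 1) *
          (2 ^ (r + 1) * ‖p‖ ^ ((r + 1).choose 2))) := by
          gcongr
          exacts [pow_le_one₀ (norm_nonneg _) hx.le, norm_altPoch_le _ hp _,
            norm_altPoch_le _ hp _, norm_altPoch_pow_le hp _ _]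
      _ = _ := by rw [mul_pow, mul_pow]; ring
  rw [e, norm_mul]
  refine mul_le_mul ?_ hg (norm_nonneg _) (by positivity)
  simp only [norm_mul (1 - x * p ^ (2 * r + 1)), norm_mul ((1 - x * p ^ (2 * r + 1)) * qPoch x p r),
    norm_mul ((qPoch p p (r + 1))⁻¹ * (qPoch (x * B) p (r + 1))⁻¹ *
      (qPoch (x * C) p (r + 1))⁻¹), norm_mul ((qPoch p p (r + 1))⁻¹ * (qPoch (x * B) p (r + 1))⁻¹),
    norm_mul ((qPoch p p (r + 1))⁻¹)]
  gcongr
  exacts [h1 _, h2 _, h3 _, h4 _, h5 _ _]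

lemma summable_lambertTerm_mul_vwpTerm {x p B C : ℂ} (hp : ‖p‖ < 1) (hx : ‖x‖ < 1)
    (hB : ∀ n, qPoch (x * B) p n ≠ 0) (hC : ∀ n, qPoch (x * C) p n ≠ 0) :
    Summable fun z : ℕ × ℕ => lambertTerm x p z.1 * vwpTerm x p B C (p ^ (z.1 + 1)) z.2 := by
  obtain ⟨M, hM⟩ := vwpTerm_pow_bound hp hx hB hC
  have h1 := (summable_lambertTerm hp hx).norm
  have h2 := (((summable_nat_add_iff 1).2 (summable_pow_mul_pow_choose
    ((‖B‖ + 1) * (‖C‖ + 1) * 2) (norm_nonneg p) hp)).mul_left M)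
  refine .of_norm_bounded (h1.mul_of_nonneg h2 (fun _ => norm_nonneg _)
    fun r => (norm_nonneg _).trans (hM 0 r)) fun z => ?_
  rw [norm_mul]
  exact mul_le_mul_of_nonneg_left (hM _ _) (norm_nonneg _)

/-- Terms with n < r vanish; the rest is a ₁φ₁ whose sum cancels the inverse factor (x
p^(r+1);p)_(r+1). -/
lemma tsum_lambertTerm_mul_vwpTerm_left {x p B C : ℂ} (hp : ‖p‖ < 1) (hx : ‖x‖ < 1)
    (hB : ∀ n, qPoch (x * B) p n ≠ 0) (hC : ∀ n, qPoch (x * C) p n ≠ 0) (r : ℕ) :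
    ∑' n, lambertTerm x p n * vwpTerm x p B C (p ^ (n + 1)) r = wellPoisedTerm x p B C r := by
  have hs : Summable fun n => lambertTerm x p n * vwpTerm x p B C (p ^ (n + 1)) r :=
    (summable_lambertTerm_mul_vwpTerm hp hx hB hC).prod_symm.prod_factor r
  have hX := qPoch_shift_ne_zero (qPoch_ne_zero hx hp) (r + 1)
  rw [← hs.sum_add_tsum_nat_add r, Finset.sum_eq_zero, zero_add]
  · simp only [lambertTerm_mul_vwpTerm_add hp hx, tsum_mul_left]
    rw [tsum_phiTerm hp hX, mul_assoc, inv_mul_cancel₀ (hX _), mul_one]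
  · exact fun n hn => lambertTerm_mul_vwpTerm_eq_zero x p B C (Finset.mem_range.1 hn)

/-- The sum stops at r = n and is evaluated by the terminating ₆φ₅; the subtracted term accounts for
the leading 1 of that series. -/
lemma tsum_lambertTerm_mul_vwpTerm_right {x p B C : ℂ} (hp : ‖p‖ < 1) (hx : ‖x‖ < 1)
    (hB : ∀ n, qPoch (x * B) p n ≠ 0) (hC : ∀ n, qPoch (x * C) p n ≠ 0) (n : ℕ) :
    ∑' r, lambertTerm x p n * vwpTerm x p B C (p ^ (n + 1)) r
      = balancedTerm x p B C n - lambertTerm x p n := by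
  rw [tsum_eq_sum (s := Finset.range (n + 1)) fun r hr =>
    lambertTerm_mul_vwpTerm_eq_zero x p B C (by simpa using hr), ← Finset.mul_sum]
  have h := vwp_terminating hp hB hC (qPoch_ne_zero hx hp) (n + 1) le_rfl
  have hX := qPoch_ne_zero hx hp (n + 1)
  have hB := hB (n + 1)
  have hC := hC (n + 1)
  have hP := one_sub_pow_succ_ne_zero hp n
  generalize ∑ r ∈ Finset.range (n + 1), vwpTerm x p B C (p ^ (n + 1)) r = S at *
  rw [eq_sub_iff_add_eq, balancedTerm, lambertTerm]
  field_simp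
  linear_combination p ^ ((n + 1).choose 2) * x ^ (n + 1) * h

/-- The two-parameter transformation expressing the Lambert series `∑ x^m / (1 - p^m)` as the
difference of a very-well-poised series and a balanced series. -/
theorem lambert_eq_wellPoised_sub_balanced {x p B C : ℂ} (hp : ‖p‖ < 1) (hx : ‖x‖ < 1)
    (hB : ∀ n, qPoch (x * B) p n ≠ 0) (hC : ∀ n, qPoch (x * C) p n ≠ 0) :
    Summable (balancedTerm x p B C) ∧ Summable (wellPoisedTerm x p B C) ∧
      lambert x p = ∑' r, wellPoisedTerm x p B C r - ∑' n, balancedTerm x p B C n := by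
  have hs := summable_lambertTerm_mul_vwpTerm hp hx hB hC
  have hl := hasSum_lambertTerm hp hx
  have h1 : Summable fun n => balancedTerm x p B C n - lambertTerm x p n :=
    hs.prod.congr fun n => (tsum_lambertTerm_mul_vwpTerm_right hp hx hB hC n)
  have h2 : Summable (balancedTerm x p B C) :=
    (h1.add hl.summable).congr fun n => by ring
  have h3 : Summable (wellPoisedTerm x p B C) :=
    hs.prod_symm.prod.congr fun r => (tsum_lambertTerm_mul_vwpTerm_left hp hx hB hC r)
  refine ⟨h2, h3, ?_⟩
  have h4 := Summable.tsum_comm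
    (f := fun n r => lambertTerm x p n * vwpTerm x p B C (p ^ (n + 1)) r) hs
  rw [tsum_congr (tsum_lambertTerm_mul_vwpTerm_right hp hx hB hC),
    tsum_congr (tsum_lambertTerm_mul_vwpTerm_left hp hx hB hC), h2.tsum_sub hl.summable,
    hl.tsum_eq] at h4
  rw [h4]
  ring

/-! ### Clausen's expansion -/

/-- The term of index `r + 1` of Clausen's form of the Lambert series. -/
noncomputable def clausenTerm (x p : ℂ) (r : ℕ) : ℂ :=
  (1 - x * p ^ (2 * r + 1)) * (p ^ (r * (r + 1)) * x ^ (r + 1)) /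
    ((1 - x * p ^ r) * (1 - p ^ (r + 1)))

/-- Clausen's transformation of the Lambert series `∑ x^m / (1 - p^m)`. -/
lemma hasSum_clausenTerm {x p : ℂ} (hp : ‖p‖ < 1) (hx : ‖x‖ < 1) :
    HasSum (clausenTerm x p) (lambert x p) := by
  rcases eq_or_ne x 0 with rfl | hx0
  · have h1 : clausenTerm 0 p = fun _ => 0 := by funext r; simp [clausenTerm]
    have h2 : lambert 0 p = 0 := by simp [lambert]
    rw [h1, h2]
    exact hasSum_zero
  -- With c = -1 and d = -x one has x/(cd) = 1, which kills the balanced series, while {x/c, x/d} =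
  -- {d, c} makes the well-poised factors cancel.
  have hx' : ∀ n, qPoch (x * (-1)⁻¹) p n ≠ 0 :=
    qPoch_ne_zero (by simpa using hx) hp
  have hone : ∀ n, qPoch (x * (-x)⁻¹) p n ≠ 0 := fun n => by
    have e : x * (-x)⁻¹ = -1 := by field_simp
    rw [e]
    refine Finset.prod_ne_zero_iff.2 fun i _ => ?_
    rcases i with _ | i
    · norm_num
    · simpa using one_add_pow_ne_zero hp i
  obtain ⟨-, h1, h2⟩ := lambert_eq_wellPoised_sub_balanced hp hx hx' hone
  have e1 : ∀ n, balancedTerm x p (-1)⁻¹ (-x)⁻¹ n = 0 := fun n => by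
    have : x * (-1)⁻¹ * (-x)⁻¹ = 1 := by field_simp
    rw [balancedTerm, this, qPoch_one_succ]
    simp
  have e2 : wellPoisedTerm x p (-1)⁻¹ (-x)⁻¹ = clausenTerm x p := by
    funext r
    have n1 := hx' (r + 1)
    have n2 := hone (r + 1)
    have n3 := one_sub_pow_succ_ne_zero hp r
    have n4 := one_sub_mul_pow_ne_zero hx hp r
    have f1 : x * (-1)⁻¹ = -x := by field_simp
    have f2 : x * (-x)⁻¹ = -1 := by field_simp
    have e3 : x ^ (2 * (r + 1)) = x ^ (r + 1) * x ^ (r + 1) := by ring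
    rw [f1] at n1
    rw [f2] at n2
    rw [wellPoisedTerm, clausenTerm, altPoch_inv (by norm_num), altPoch_inv (by simpa using hx0),
      f1, f2, neg_pow x, e3]
    have hs : (-1 : ℂ) ^ (r + 1) * (-1) ^ (r + 1) = 1 := by rw [← mul_pow]; simp
    have hs0 : (-1 : ℂ) ^ (r + 1) ≠ 0 := by simp
    have hxr : x ^ (r + 1) ≠ 0 := pow_ne_zero _ hx0
    generalize (-1 : ℂ) ^ (r + 1) = s at *
    generalize x ^ (r + 1) = y at *
    generalize qPoch (-1) p (r + 1) = P at *
    generalize qPoch (-x) p (r + 1) = Q at *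
    generalize 1 - x * p ^ (2 * r + 1) = a at *
    generalize p ^ (r * (r + 1)) = b at *
    generalize 1 - p ^ (r + 1) = c at *
    generalize 1 - x * p ^ r = d at *
    rw [div_mul_div_comm, ← mul_assoc s s y, hs, one_mul]
    field_simp
  rw [e2] at h1 h2
  simp only [h2, e1, tsum_zero, sub_zero]
  exact h1.hasSum

/-! ### Reindexing and assembly -/

lemma hasSum_pnat {f : ℕ+ → ℂ} {g : ℕ → ℂ} {a : ℂ} (h : HasSum g a)
    (hfg : ∀ n : ℕ, f n.succPNat = g n) : HasSum f a := by
  refine (Equiv.pnatEquivNat.symm.hasSum_iff).1 (h.congr_fun ?_)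
  exact hfg

/-- The integer exponents are nonnegative for n ≥ 1, so q = 0 needs no separate case in the first
two expansions. -/
lemma zpow_eq_pow_of_eq (q : ℂ) {e : ℤ} {k : ℕ} (h : e = k) : q ^ e = q ^ k := by
  rw [h, zpow_natCast]

lemma pow_choose_two_mul_pow (q : ℂ) (a k n : ℕ) (h : k + 2 * n = 2 * n ^ 2 + a * n) :
    (q ^ 4) ^ (n.choose 2) * (q ^ a) ^ n = q ^ k := by
  rw [← pow_mul, ← pow_mul, ← pow_add]
  congr 1
  have := two_mul_choose_two_add n
  linarith

lemma balancedTerm_eq {x p c d : ℂ} (hp : ‖p‖ < 1) (n : ℕ) :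
    balancedTerm x p c⁻¹ d⁻¹ n = qPoch p p n * qPoch (x / (c * d)) p (n + 1) *
        (-1) ^ (n + 1) * (p ^ ((n + 1).choose 2) * x ^ (n + 1)) /
      (qPoch (x / c) p (n + 1) * qPoch (x / d) p (n + 1) * qPoch p p (n + 1)) := by
  have h := qPoch_ne_zero hp hp n
  have e : x / (c * d) = x * c⁻¹ * d⁻¹ := by rw [div_eq_mul_inv, mul_inv, mul_assoc]
  rw [balancedTerm, qPoch_succ p p n, ← pow_succ', e, div_eq_mul_inv x c, div_eq_mul_inv x d,
    ← mul_div_mul_left _ _ h]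
  congr 1 <;> ring

/-- Here y = x/p, and 1/(1 - x p^r) is rewritten as (y)_(r+1)/((1-y)(x)_(r+1)). -/
lemma wellPoisedTerm_eq {x y p c d : ℂ} (hp : ‖p‖ < 1) (hx : ‖x‖ < 1) (hy : y * p = x)
    (hy1 : y ≠ 1) (hc : c ≠ 0) (hd : d ≠ 0) (r : ℕ) :
    wellPoisedTerm x p c⁻¹ d⁻¹ r = (1 - x * p ^ (2 * r + 1)) * qPoch p p r *
        (qPoch y p (r + 1) * qPoch c p (r + 1) * qPoch d p (r + 1)) *
        (p ^ (r * (r + 1)) * x ^ (2 * (r + 1))) /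
      ((1 - y) * (qPoch (x / c) p (r + 1) * qPoch (x / d) p (r + 1) * qPoch x p (r + 1) *
        qPoch p p (r + 1)) * c ^ (r + 1) * d ^ (r + 1)) := by
  have h1 := qPoch_ne_zero hp hp r
  have h2 := qPoch_ne_zero hx hp r
  have h3 : 1 - y ≠ 0 := sub_ne_zero.2 hy1.symm
  have h : qPoch p p r * qPoch x p r * (1 - y) ≠ 0 := mul_ne_zero (mul_ne_zero h1 h2) h3
  rw [wellPoisedTerm, qPoch_succ p p r, ← pow_succ', qPoch_succ' y, hy, qPoch_succ x p r,
    altPoch_inv hc, altPoch_inv hd, div_eq_mul_inv x c, div_eq_mul_inv x d, div_mul_div_comm,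
    ← mul_div_assoc, div_div, ← mul_div_mul_left _ _ h]
  congr 1 <;> ring

theorem mainTheorem9 (q : ℂ) (hq : ‖q‖ < 1) :
    -- the theta series converges
    Summable (fun n : ℤ => q ^ (n ^ 2)) ∧
    -- first expansion
    (∃ A B : ℂ,
      HasSum (fun n : ℕ+ =>
        (-1) ^ (n : ℕ) * q ^ (2 * (n : ℤ) ^ 2 - (n : ℤ)) /
          (qPoch q (q ^ 4) n * (1 - q ^ (4 * (n : ℤ))))) A ∧
      HasSum (fun n : ℕ+ =>
        (-1) ^ (n : ℕ) * q ^ (2 * (n : ℤ) ^ 2 + (n : ℤ)) /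
          (qPoch (q ^ 3) (q ^ 4) n * (1 - q ^ (4 * (n : ℤ))))) B ∧
      ramanujanPhi q ^ 2 = 1 - 4 * A + 4 * B) ∧
    -- second expansion
    (∃ A B : ℂ,
      HasSum (fun n : ℕ+ =>
        (1 - q ^ (8 * (n : ℤ) - 3)) * q ^ (4 * (n : ℤ) ^ 2 - 3 * (n : ℤ)) /
          ((1 - q ^ (4 * (n : ℤ) - 3)) * (1 - q ^ (4 * (n : ℤ))))) A ∧
      HasSum (fun n : ℕ+ =>
        (1 - q ^ (8 * (n : ℤ) - 1)) * q ^ (4 * (n : ℤ) ^ 2 - (n : ℤ)) /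
          ((1 - q ^ (4 * (n : ℤ) - 1)) * (1 - q ^ (4 * (n : ℤ))))) B ∧
      ramanujanPhi q ^ 2 = 1 + 4 * A - 4 * B) ∧
    -- the identity with two free parameters that make no denominator vanish
    (∀ c d : ℂ, q ≠ 0 → c ≠ 0 → d ≠ 0 →
      (∀ n : ℕ, qPoch (q ^ 3 / c) (q ^ 4) n ≠ 0) →
      (∀ n : ℕ, qPoch (q ^ 3 / d) (q ^ 4) n ≠ 0) →
      (∀ n : ℕ, qPoch (q / c) (q ^ 4) n ≠ 0) →
      (∀ n : ℕ, qPoch (q / d) (q ^ 4) n ≠ 0) →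
      ∃ S₁ S₂ S₃ S₄ : ℂ,
        HasSum (fun n : ℕ+ =>
          qPoch (q ^ 4) (q ^ 4) ((n : ℕ) - 1) * qPoch (q ^ 3 / (c * d)) (q ^ 4) n *
              (-1) ^ (n : ℕ) * q ^ (2 * (n : ℤ) ^ 2 + (n : ℤ)) /
            (qPoch (q ^ 3 / c) (q ^ 4) n * qPoch (q ^ 3 / d) (q ^ 4) n *
              qPoch (q ^ 4) (q ^ 4) n)) S₁ ∧
        HasSum (fun n : ℕ+ =>
          qPoch (q ^ 4) (q ^ 4) ((n : ℕ) - 1) * qPoch (q / (c * d)) (q ^ 4) n *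
              (-1) ^ (n : ℕ) * q ^ (2 * (n : ℤ) ^ 2 - (n : ℤ)) /
            (qPoch (q / c) (q ^ 4) n * qPoch (q / d) (q ^ 4) n *
              qPoch (q ^ 4) (q ^ 4) n)) S₂ ∧
        HasSum (fun n : ℕ+ =>
          (1 - q ^ (8 * (n : ℤ) - 1)) * qPoch (q ^ 4) (q ^ 4) ((n : ℕ) - 1) *
              (qPoch (1 / q) (q ^ 4) n * qPoch c (q ^ 4) n * qPoch d (q ^ 4) n) *
              q ^ (4 * (n : ℤ) ^ 2 + 2 * (n : ℤ)) /
            ((1 - 1 / q) *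
              (qPoch (q ^ 3 / c) (q ^ 4) n * qPoch (q ^ 3 / d) (q ^ 4) n *
                qPoch (q ^ 3) (q ^ 4) n * qPoch (q ^ 4) (q ^ 4) n) *
              c ^ (n : ℕ) * d ^ (n : ℕ))) S₃ ∧
        HasSum (fun n : ℕ+ =>
          (1 - q ^ (8 * (n : ℤ) - 3)) * qPoch (q ^ 4) (q ^ 4) ((n : ℕ) - 1) *
              (qPoch (1 / q ^ 3) (q ^ 4) n * qPoch c (q ^ 4) n * qPoch d (q ^ 4) n) *
              q ^ (4 * (n : ℤ) ^ 2 - 2 * (n : ℤ)) /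
            ((1 - 1 / q ^ 3) *
              (qPoch (q / c) (q ^ 4) n * qPoch (q / d) (q ^ 4) n *
                qPoch q (q ^ 4) n * qPoch (q ^ 4) (q ^ 4) n) *
              c ^ (n : ℕ) * d ^ (n : ℕ))) S₄ ∧
        ramanujanPhi q ^ 2 = 1 + 4 * S₁ - 4 * S₂ - 4 * S₃ + 4 * S₄) := by
  have hp : ‖q ^ 4‖ < 1 := norm_pow_lt_one hq 3
  have hx : ‖q ^ 3‖ < 1 := norm_pow_lt_one hq 2
  have hphi := ramanujanPhi_sq_eq_lambert hq
  have z4 : ∀ n : ℕ, q ^ (4 * ((n.succPNat : ℕ) : ℤ)) = (q ^ 4) ^ (n + 1) := fun n => by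
    rw [← pow_mul]
    exact zpow_eq_pow_of_eq q (by push_cast [Nat.succPNat_coe]; ring)
  have zm : ∀ n : ℕ, q ^ (2 * ((n.succPNat : ℕ) : ℤ) ^ 2 - ((n.succPNat : ℕ) : ℤ))
      = (q ^ 4) ^ ((n + 1).choose 2) * q ^ (n + 1) := fun n => by
    have := pow_choose_two_mul_pow q 1 (2 * n ^ 2 + 3 * n + 1) (n + 1) (by ring)
    rw [pow_one] at this
    rw [this]
    exact zpow_eq_pow_of_eq q (by push_cast [Nat.succPNat_coe]; ring)
  have zp : ∀ n : ℕ, q ^ (2 * ((n.succPNat : ℕ) : ℤ) ^ 2 + ((n.succPNat : ℕ) : ℤ))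
      = (q ^ 4) ^ ((n + 1).choose 2) * (q ^ 3) ^ (n + 1) := fun n => by
    rw [pow_choose_two_mul_pow q 3 (2 * n ^ 2 + 5 * n + 3) (n + 1) (by ring)]
    exact zpow_eq_pow_of_eq q (by push_cast [Nat.succPNat_coe]; ring)
  have z83 : ∀ n : ℕ, q ^ (8 * ((n.succPNat : ℕ) : ℤ) - 3) = q * (q ^ 4) ^ (2 * n + 1) :=
    fun n => by
      rw [← pow_mul, ← pow_succ']
      exact zpow_eq_pow_of_eq q (by push_cast [Nat.succPNat_coe]; ring)
  have z81 : ∀ n : ℕ, q ^ (8 * ((n.succPNat : ℕ) : ℤ) - 1) = q ^ 3 * (q ^ 4) ^ (2 * n + 1) :=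
    fun n => by
      rw [← pow_mul, ← pow_add]
      exact zpow_eq_pow_of_eq q (by push_cast [Nat.succPNat_coe]; ring)
  refine ⟨(hasSum_theta hq).summable, ⟨-lambert q (q ^ 4), -lambert (q ^ 3) (q ^ 4),
    hasSum_pnat (hasSum_lambertTerm hp hq) fun n => ?_,
    hasSum_pnat (hasSum_lambertTerm hp hx) fun n => ?_, by rw [hphi]; ring⟩,
    ⟨lambert q (q ^ 4), lambert (q ^ 3) (q ^ 4),
    hasSum_pnat (hasSum_clausenTerm hp hq) fun n => ?_,
    hasSum_pnat (hasSum_clausenTerm hp hx) fun n => ?_, by rw [hphi]; ring⟩, ?_⟩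
  · rw [zm, z4, lambertTerm, Nat.succPNat_coe, mul_assoc]
  · rw [zp, z4, lambertTerm, Nat.succPNat_coe, mul_assoc]
  · have h1 : q ^ (4 * ((n.succPNat : ℕ) : ℤ) ^ 2 - 3 * ((n.succPNat : ℕ) : ℤ))
        = (q ^ 4) ^ (n * (n + 1)) * q ^ (n + 1) := by
      rw [← pow_mul, ← pow_add]
      exact zpow_eq_pow_of_eq q (by push_cast [Nat.succPNat_coe]; ring)
    have h2 : q ^ (4 * ((n.succPNat : ℕ) : ℤ) - 3) = q * (q ^ 4) ^ n := by
      rw [← pow_mul, ← pow_succ']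
      exact zpow_eq_pow_of_eq q (by push_cast [Nat.succPNat_coe]; ring)
    rw [z83, z4, h1, h2, clausenTerm]
  · have h1 : q ^ (4 * ((n.succPNat : ℕ) : ℤ) ^ 2 - ((n.succPNat : ℕ) : ℤ))
        = (q ^ 4) ^ (n * (n + 1)) * (q ^ 3) ^ (n + 1) := by
      rw [← pow_mul, ← pow_mul, ← pow_add]
      exact zpow_eq_pow_of_eq q (by push_cast [Nat.succPNat_coe]; ring)
    have h2 : q ^ (4 * ((n.succPNat : ℕ) : ℤ) - 1) = q ^ 3 * (q ^ 4) ^ n := by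
      rw [← pow_mul, ← pow_add]
      exact zpow_eq_pow_of_eq q (by push_cast [Nat.succPNat_coe]; ring)
    rw [z81, z4, h1, h2, clausenTerm]
  intro c d hq0 hc hd h3c h3d h1c h1d
  obtain ⟨s1, s3, e3⟩ := lambert_eq_wellPoised_sub_balanced (x := q ^ 3) (B := c⁻¹) (C := d⁻¹)
    hp hx h3c h3d
  obtain ⟨s2, s4, e1⟩ := lambert_eq_wellPoised_sub_balanced (x := q) (B := c⁻¹) (C := d⁻¹)
    hp hq h1c h1d
  -- Ensures that the denominators 1 - 1/q and 1 - 1/q^3 are nonzero.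
  have hne : ∀ k : ℕ, 1 / q ^ (k + 1) ≠ 1 := fun k h => by
    have h2 := norm_pow_lt_one hq k
    rw [div_eq_one_iff_eq (pow_ne_zero _ hq0)] at h
    rw [← h, norm_one] at h2
    exact lt_irrefl _ h2
  refine ⟨_, _, _, _, hasSum_pnat s1.hasSum fun n => ?_, hasSum_pnat s2.hasSum fun n => ?_,
    hasSum_pnat s3.hasSum fun n => ?_, hasSum_pnat s4.hasSum fun n => ?_,
    by rw [hphi, e1, e3]; ring⟩
  · rw [zp, balancedTerm_eq hp, Nat.succPNat_coe, Nat.succ_sub_one]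
  · rw [zm, balancedTerm_eq hp, Nat.succPNat_coe, Nat.succ_sub_one]
  · have h1 : q ^ (4 * ((n.succPNat : ℕ) : ℤ) ^ 2 + 2 * ((n.succPNat : ℕ) : ℤ))
        = (q ^ 4) ^ (n * (n + 1)) * (q ^ 3) ^ (2 * (n + 1)) := by
      rw [← pow_mul, ← pow_mul, ← pow_add]
      exact zpow_eq_pow_of_eq q (by push_cast [Nat.succPNat_coe]; ring)
    rw [z81, h1, wellPoisedTerm_eq (y := 1 / q) hp hx (by field_simp) (by simpa using hne 0) hc hd,
      Nat.succPNat_coe, Nat.succ_sub_one]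
  · have h1 : q ^ (4 * ((n.succPNat : ℕ) : ℤ) ^ 2 - 2 * ((n.succPNat : ℕ) : ℤ))
        = (q ^ 4) ^ (n * (n + 1)) * q ^ (2 * (n + 1)) := by
      rw [← pow_mul, ← pow_add]
      exact zpow_eq_pow_of_eq q (by push_cast [Nat.succPNat_coe]; ring)
    rw [z83, h1, wellPoisedTerm_eq (y := 1 / q ^ 3) hp hq (by field_simp) (hne 2) hc hd,
      Nat.succPNat_coe, Nat.succ_sub_one]
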